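/- **Conventions.** Let $\epsilon\in\{1,-1\}$ and $n\ge 1$. On $\mathbb{E}^{n+1}=\mathbb{R}^{n+1}$ take the flat metric $\langle x,y\rangle=\epsilon x_1y_1+x_2y_2+\dots+x_{n+1}y_{n+1}$ and let $\mathbb{Q}^n_\epsilon=\{x\in\mathbb{E}^{n+1}:\langle x,x\rangle=\epsilon\}$, with $x_1>0$ required if $\epsilon=-1$; thus $\mathbb{Q}^n_1=\mathbb{S}^n$ and $\mathbb{Q}^n_{-1}=\mathbb{H}^n$. Regard $\mathbb{Q}^n_\epsilon\times\mathbb{R}\subset\mathbb{E}^{n+1}\times\mathbb{R}$ with the product metric, and let $\partial/\partial t=(0,1)$. A hypersurface is a smooth immersion of a smooth manifold of codimension one. Put $C_1=\cos$, $S_1=\sin$, $C_{-1}=\cosh$, $S_{-1}=\sinh$. For a hypersurface $g\colon M^{n-1}\to\mathbb{Q}^n_\epsilon$ with a smooth unit normal field $N$ tangent to $\mathbb{Q}^n_\epsilon$, its parallel hypersurfaces are $g_s(x)=C_\epsilon(s)g(x)+S_\epsilon(s)N(x)$. **Theorem.** Let $M^n$ be a connected smooth manifold (Hausdorff, second countable,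 without boundary) and let $f\colon M^n\to\mathbb{Q}^n_\epsilon\times\mathbb{R}$ be a hypersurface. Suppose that there are a constant $\nu\in\mathbb{R}$ and, for every $p\in M^n$, a unit vector $\eta(p)$ tangent to $\mathbb{Q}^n_\epsilon\times\mathbb{R}$ at $f(p)$ and normal to $f$ at $p$, with $\langle\eta(p),\partial/\partial t\rangle=\nu$ for all $p$. Then at least one of the following holds. 1. There is $t_0\in\mathbb{R}$ such that $f(W)$ is an open subset of the slice $\mathbb{Q}^n_\epsilon\times\{t_0\}$ for every open $W\subseteq M^n$; in particular $f(M^n)$ is an open subset of the slice. 2. There are a second countable, not necessarily Hausdorff, smooth manifold $M^{n-1}$, a hypersurface $g\colon M^{n-1}\to\mathbb{Q}^n_\epsilon$, and a diffeomorphism $\psi$ of $M^n$ onto an open subset of $M^{n-1}\times\mathbb{R}$ such that $f=(g\times\mathrm{id}_{\mathbb{R}})\circ\psi$. 3. For every $p\in M^n$ there are a hypersurface $g\colon M^{n-1}\to\mathbb{Q}^n_\epsilon$ of a (Hausdorff, second countable) smooth manifold $M^{n-1}$ with a smooth unit normal field $N$, an open set $V\subseteq M^{n-1}$, an open interval $I\ni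 0$, constants $B>0$ and $t_0\in\mathbb{R}$, and a diffeomorphism $\varphi$ of $V\times I$ onto an open neighbourhood of $p$ in $M^n$, such that $g_s$ is an immersion on $V$ for every $s\in I$, and $$f(\varphi(x,s))=g_s(x)+(Bs+t_0)\frac{\partial}{\partial t}\qquad\text{for all }(x,s)\in V\times I.$$ -/

import Mathlib

open scoped Manifold ContDiff

universe u

namespace ConstantAngle

/-- The coordinate space `ℝ^(n+1)` underlying the flat space `𝔼^(n+1)` that contains `ℚ_ε^n`;
the coordinate `x₁` is the one with index `0`. -/
abbrev Flat (n : ℕ) : Type := EuclideanSpace ℝ (Fin (n + 1))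

/-- The flat metric `ε dx₁² + dx₂² + ⋯ + dx_{n+1}²` on `𝔼^(n+1)`. -/
def flatMetric (ε : ℝ) {n : ℕ} (x y : Flat n) : ℝ :=
  ε * (x 0 * y 0) + ∑ i : Fin n, x i.succ * y i.succ

/-- The flat metric on `𝔼^(n+2) = 𝔼^(n+1) × ℝ`. -/
def prodMetric (ε : ℝ) {n : ℕ} (u v : Flat n × ℝ) : ℝ :=
  flatMetric ε u.1 v.1 + u.2 * v.2

/-- The vector `∂/∂t` of `𝔼^(n+1) × ℝ`. -/
def dt (n : ℕ) : Flat n × ℝ := (0, 1)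

/-- `ℚ_ε^n`: the sphere `𝕊^n` if `ε = 1`, the hyperbolic space `ℍ^n` (upper sheet of the
hyperboloid) if `ε = -1`. -/
def quadric (ε : ℝ) (n : ℕ) : Set (Flat n) :=
  {x | flatMetric ε x x = ε ∧ (ε = -1 → 0 < x 0)}

/-- `C_ε`: `cos` if `ε = 1`, `cosh` if `ε = -1`. -/
noncomputable def cosE (ε s : ℝ) : ℝ := if ε = 1 then Real.cos s else Real.cosh s

/-- `S_ε`: `sin` if `ε = 1`, `sinh` if `ε = -1`. -/
noncomputable def sinE (ε s : ℝ) : ℝ := if ε = 1 then Real.sin s else Real.sinh s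

/-- A hypersurface `g : M^m → ℚ_ε^(m+1)`: a smooth immersion into the ambient flat space with
values in `ℚ_ε^(m+1)`. -/
structure IsHypersurfaceQ (ε : ℝ) (m : ℕ) {M : Type*} [TopologicalSpace M]
    [ChartedSpace (EuclideanSpace ℝ (Fin m)) M] (g : M → Flat (m + 1)) : Prop where
  smooth : ContMDiff (𝓡 m) 𝓘(ℝ, Flat (m + 1)) ∞ g
  mem : ∀ x, g x ∈ quadric ε (m + 1)
  immersion : ∀ x, Function.Injective (mfderiv (𝓡 m) 𝓘(ℝ, Flat (m + 1)) g x)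

/-- A smooth unit normal vector field to `g : M^m → ℚ_ε^(m+1)`. The condition
`⟨N x, g x⟩ = 0` says that `N x` is tangent to `ℚ_ε^(m+1)` at `g x`. -/
structure IsUnitNormalFieldQ (ε : ℝ) (m : ℕ) {M : Type*} [TopologicalSpace M]
    [ChartedSpace (EuclideanSpace ℝ (Fin m)) M] (g N : M → Flat (m + 1)) : Prop where
  smooth : ContMDiff (𝓡 m) 𝓘(ℝ, Flat (m + 1)) ∞ N
  tangent : ∀ x, flatMetric ε (N x) (g x) = 0
  normal : ∀ x (v : TangentSpace (𝓡 m) x),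
    flatMetric ε (N x) (mfderiv (𝓡 m) 𝓘(ℝ, Flat (m + 1)) g x v) = 0
  unit : ∀ x, flatMetric ε (N x) (N x) = 1

/-- The parallel hypersurface `g_s = C_ε(s) g + S_ε(s) N` of `g` with respect to `N`. -/
noncomputable def parallel (ε : ℝ) {n : ℕ} {M : Type*} (g N : M → Flat n) (s : ℝ) (x : M) :
    Flat n :=
  cosE ε s • g x + sinE ε s • N x

/-- A hypersurface `f : M^(m+1) → ℚ_ε^(m+1) × ℝ`: a smooth immersion into the ambient flat
space with values in `ℚ_ε^(m+1) × ℝ`. -/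
structure IsHypersurface (ε : ℝ) (m : ℕ) {M : Type*} [TopologicalSpace M]
    [ChartedSpace (EuclideanSpace ℝ (Fin (m + 1))) M] (f : M → Flat (m + 1) × ℝ) : Prop where
  smooth : ContMDiff (𝓡 (m + 1)) 𝓘(ℝ, Flat (m + 1) × ℝ) ∞ f
  mem : ∀ p, (f p).1 ∈ quadric ε (m + 1)
  immersion : ∀ p, Function.Injective (mfderiv (𝓡 (m + 1)) 𝓘(ℝ, Flat (m + 1) × ℝ) f p)

/-- `η` selects at each point a unit normal vector to `f : M^(m+1) → ℚ_ε^(m+1) × ℝ`: a unit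
vector tangent to `ℚ_ε^(m+1) × ℝ` and orthogonal to the image of the differential. No continuity
of `η` is required. -/
structure IsUnitNormal (ε : ℝ) (m : ℕ) {M : Type*} [TopologicalSpace M]
    [ChartedSpace (EuclideanSpace ℝ (Fin (m + 1))) M] (f η : M → Flat (m + 1) × ℝ) : Prop where
  tangent : ∀ p, flatMetric ε (η p).1 (f p).1 = 0
  normal : ∀ p (v : TangentSpace (𝓡 (m + 1)) p),
    prodMetric ε (η p) (mfderiv (𝓡 (m + 1)) 𝓘(ℝ, Flat (m + 1) × ℝ) f p v) = 0
  unit : ∀ p, prodMetric ε (η p) (η p) = 1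

/-- `f` is an open part of a slice `ℚ_ε^n × {t₀}`: it takes open sets (in particular the whole
domain) onto open subsets of the slice. -/
def IsOpenPartOfSlice (ε : ℝ) {n : ℕ} {M : Type*} [TopologicalSpace M]
    (f : M → Flat n × ℝ) : Prop :=
  ∃ t₀ : ℝ, ∀ W : Set M, IsOpen W →
    ∃ U : Set (Flat n), IsOpen U ∧ f '' W = (U ∩ quadric ε n) ×ˢ {t₀}

/-- `f` is an open part of a product `M' × ℝ`, where `g : M' → ℚ_ε^(m+1)` is a hypersurface:
up to a diffeomorphism `ψ` of `M` onto an open subset of `M' × ℝ`, `f` is the restriction of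
`g × id`. The manifold `M'` is second countable, but need not be Hausdorff. -/
def IsOpenPartOfProduct (ε : ℝ) (m : ℕ) {M : Type u} [TopologicalSpace M]
    [ChartedSpace (EuclideanSpace ℝ (Fin (m + 1))) M] (f : M → Flat (m + 1) × ℝ) : Prop :=
  ∃ (M' : Type u) (_ : TopologicalSpace M') (_ : SecondCountableTopology M')
    (_ : ChartedSpace (EuclideanSpace ℝ (Fin m)) M') (_ : IsManifold (𝓡 m) ∞ M')
    (g : M' → Flat (m + 1)) (ψ : M → M' × ℝ),
    IsHypersurfaceQ ε m g ∧
    Function.Injective ψ ∧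
    IsLocalDiffeomorph (𝓡 (m + 1)) ((𝓡 m).prod 𝓘(ℝ, ℝ)) ∞ ψ ∧
    ∀ p, f p = (g (ψ p).1, (ψ p).2)

/-- Near `p`, and up to a translation `t₀` in the `∂/∂t` direction, `f` is
`(x, s) ↦ g_s(x) + B s ∂/∂t` on `V × (a, b)`, where `0 ∈ (a, b)`, `B > 0`, `V` is open in `M'`,
`g_s` are the parallel hypersurfaces to a hypersurface `g : M' → ℚ_ε^(m+1)` with respect to a unit
normal field, and each `g_s`, `s ∈ (a, b)`, is an immersion on `V`. -/
def IsParallelFamilyNear (ε : ℝ) (m : ℕ) {M : Type*} [TopologicalSpace M]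
    [ChartedSpace (EuclideanSpace ℝ (Fin (m + 1))) M] (f : M → Flat (m + 1) × ℝ) (p : M) :
    Prop :=
  ∃ (M' : Type) (_ : TopologicalSpace M') (_ : T2Space M') (_ : SecondCountableTopology M')
    (_ : ChartedSpace (EuclideanSpace ℝ (Fin m)) M') (_ : IsManifold (𝓡 m) ∞ M')
    (g N : M' → Flat (m + 1)) (V : Set M') (a b B t₀ : ℝ)
    (φ : PartialDiffeomorph ((𝓡 m).prod 𝓘(ℝ, ℝ)) (𝓡 (m + 1)) (M' × ℝ) M ∞),
    IsHypersurfaceQ ε m g ∧ IsUnitNormalFieldQ ε m g N ∧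
    IsOpen V ∧ a < 0 ∧ 0 < b ∧ 0 < B ∧
    (∀ s ∈ Set.Ioo a b, ∀ x ∈ V,
      Function.Injective (mfderiv (𝓡 m) 𝓘(ℝ, Flat (m + 1)) (parallel ε g N s) x)) ∧
    φ.source = V ×ˢ Set.Ioo a b ∧ p ∈ φ.target ∧
    ∀ x ∈ V, ∀ s ∈ Set.Ioo a b,
      f (φ (x, s)) = (parallel ε g N s x, 0) + (B * s + t₀) • dt (m + 1)

end ConstantAngle

/-! The component `(η p).1` is tangent to the quadric, where the flat metric is positive definite,
and its square is `1 - ν ^ 2`; hence `ν ^ 2 ≤ 1`, and the three alternatives correspond to `ν ^ 2 =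
1`, `ν = 0` and `0 < ν ^ 2 < 1`. No continuity of `η` is assumed.

If `ν ^ 2 = 1`, the normal is vertical, so the height is locally constant, hence constant on the
connected `M`. That `f` is open into the slice follows from `IsLocalHypersurface.cone_mem_nhds`:
cones over the hypersurface fill open sets of the flat space, and each ray meets the quadric at most
once.

If `ν = 0`, then `∂/∂t` is tangent to `f` and `M` is foliated by curves that `f` maps to vertical
lines. The quotient of `M` by these curves is the required manifold: the first component of `f`
descends to an immersion `g`, and a point is determined by its line and its height. The quotient can
fail to be Hausdorff, since two segments of one vertical line separated by a gap may both be limits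
of the same unbroken lines.

Otherwise change the sign of `η` so that `ν < 0`. The tangent part of `∂/∂t`, rescaled, is `(N, B)`
with `N = c⁻¹ η₁`, `c = √(1 - ν ^ 2)`, `B = c / (-ν)`. Symmetry of the second fundamental form gives
`N' = -ε F₁` along its integral curves (`IsLocalHypersurface.fderiv_normal_apply`), while `F₁' = N`:
the curves project to unit speed geodesics normal to the level sets of the height. So `F₁` at
parameter `s` is `C_ε(s) g + S_ε(s) N`, with `g` and `N` taken on the level set `s = 0`.

No differential equation is solved: in both nonvertical cases a map is at hand that sends the field
to `(0, 1)`, and the inverse function theorem straightens it (`exists_flow_box`). -/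

namespace ConstantAngle

/-! ### The flat metrics: bilinearity, nondegeneracy, positivity on the quadric -/

section Bilinear

variable {ε : ℝ} {n : ℕ}

/-- The flat metric of `𝔼^(n+1)` as a continuous bilinear map. -/
noncomputable def flatB (ε : ℝ) (n : ℕ) : Flat n →L[ℝ] Flat n →L[ℝ] ℝ :=
  (LinearMap.mk₂ ℝ (fun x y : Flat n => flatMetric ε x y)
    (fun x y z => by simp [flatMetric, add_mul, Finset.sum_add_distrib]; ring)
    (fun a x y => by simp [flatMetric, mul_add, Finset.mul_sum, mul_assoc, mul_left_comm])
    (fun x y z => by simp [flatMetric, mul_add, Finset.sum_add_distrib]; ring)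
    (fun a x y => by
      simp [flatMetric, mul_add, Finset.mul_sum, mul_left_comm])).toContinuousBilinearMap

@[simp] theorem flatB_apply (x y : Flat n) : flatB ε n x y = flatMetric ε x y := rfl

/-- The flat metric of `𝔼^(n+1) × ℝ` as a continuous bilinear map. -/
noncomputable def prodB (ε : ℝ) (n : ℕ) : (Flat n × ℝ) →L[ℝ] (Flat n × ℝ) →L[ℝ] ℝ :=
  (flatB ε n).bilinearComp (.fst ℝ _ _) (.fst ℝ _ _) +
    (ContinuousLinearMap.mul ℝ ℝ).bilinearComp (.snd ℝ _ _) (.snd ℝ _ _)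

@[simp] theorem prodB_apply (x y : Flat n × ℝ) : prodB ε n x y = prodMetric ε x y := rfl

theorem flatMetric_comm (x y : Flat n) : flatMetric ε x y = flatMetric ε y x := by
  simp [flatMetric, mul_comm]

theorem prodMetric_comm (x y : Flat n × ℝ) : prodMetric ε x y = prodMetric ε y x := by
  simp [prodMetric, flatMetric_comm x.1, mul_comm]

theorem flatMetric_add_left (x y z : Flat n) :
    flatMetric ε (x + y) z = flatMetric ε x z + flatMetric ε y z := by
  simp [← flatB_apply]

theorem flatMetric_smul_left (a : ℝ) (x z : Flat n) :
    flatMetric ε (a • x) z = a * flatMetric ε x z := by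
  simp [← flatB_apply]

theorem flatMetric_smul_right (a : ℝ) (x z : Flat n) :
    flatMetric ε x (a • z) = a * flatMetric ε x z := by
  simp [← flatB_apply]

theorem prodMetric_add_left (x y z : Flat n × ℝ) :
    prodMetric ε (x + y) z = prodMetric ε x z + prodMetric ε y z := by
  simp [← prodB_apply]

theorem prodMetric_sub_left (x y z : Flat n × ℝ) :
    prodMetric ε (x - y) z = prodMetric ε x z - prodMetric ε y z := by
  simp [← prodB_apply]

theorem prodMetric_add_right (x y z : Flat n × ℝ) :
    prodMetric ε z (x + y) = prodMetric ε z x + prodMetric ε z y := by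
  simp [← prodB_apply]

theorem prodMetric_smul_left (a : ℝ) (x z : Flat n × ℝ) :
    prodMetric ε (a • x) z = a * prodMetric ε x z := by
  simp [← prodB_apply]

theorem prodMetric_smul_right (a : ℝ) (x z : Flat n × ℝ) :
    prodMetric ε x (a • z) = a * prodMetric ε x z := by
  simp [← prodB_apply]

theorem prodMetric_dt (x : Flat n × ℝ) : prodMetric ε x (dt n) = x.2 := by
  simp [prodMetric, dt, flatMetric]

theorem eq_zero_of_flatMetric_eq_zero (hε : ε = 1 ∨ ε = -1) {w : Flat n}
    (h : ∀ u, flatMetric ε w u = 0) : w = 0 := by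
  have hε0 : ε ≠ 0 := by rcases hε with h | h <;> simp [h]
  ext i
  refine Fin.cases ?_ (fun j => ?_) i
  · simpa [flatMetric, hε0] using h (EuclideanSpace.single 0 1)
  · simpa [flatMetric, Pi.single_apply, Fin.succ_ne_zero, (Fin.succ_ne_zero _).symm]
      using h (EuclideanSpace.single j.succ 1)

theorem eq_zero_of_prodMetric_eq_zero (hε : ε = 1 ∨ ε = -1) {w : Flat n × ℝ}
    (h : ∀ u, prodMetric ε w u = 0) : w = 0 := by
  refine Prod.ext (eq_zero_of_flatMetric_eq_zero hε fun u => ?_) ?_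
  · simpa [prodMetric] using h (u, 0)
  · simpa [prodMetric_dt] using h (dt n)

/-- The metric is positive definite on the tangent spaces of the quadric. -/
theorem flatMetric_self_nonneg_and_eq_zero (hε : ε = 1 ∨ ε = -1) {x y : Flat n}
    (hx : flatMetric ε x x = ε) (hxy : flatMetric ε y x = 0) :
    0 ≤ flatMetric ε y y ∧ (flatMetric ε y y = 0 → y = 0) := by
  have key : ∀ b : ℝ, b = ∑ i : Fin n, y i.succ * y i.succ → 0 ≤ b ∧
      (y 0 = 0 → b = 0 → y = 0) := by
    rintro b rfl
    refine ⟨Finset.sum_nonneg fun i _ => mul_self_nonneg _, fun h0 hb => ?_⟩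
    ext i
    refine Fin.cases h0 (fun j => ?_) i
    rw [Finset.sum_eq_zero_iff_of_nonneg fun i _ => mul_self_nonneg _] at hb
    simpa using hb j (Finset.mem_univ _)
  -- Cauchy–Schwarz on the last `n` coordinates is what makes tangent vectors of the hyperboloid
  -- spacelike; for the sphere, positivity is immediate.
  have cs := Finset.sum_mul_sq_le_sq_mul_sq Finset.univ
    (fun i : Fin n => y i.succ) (fun i : Fin n => x i.succ)
  have ha : 0 ≤ ∑ i : Fin n, x i.succ * x i.succ :=
    Finset.sum_nonneg fun i _ => mul_self_nonneg _
  obtain ⟨hb0, hz⟩ := key _ rfl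
  clear key
  simp only [flatMetric] at hx hxy ⊢
  simp only [pow_two] at cs
  generalize ∑ i : Fin n, y i.succ * y i.succ = b at *
  generalize ∑ i : Fin n, x i.succ * x i.succ = a at *
  generalize ∑ i : Fin n, y i.succ * x i.succ = d at *
  rcases hε with rfl | rfl
  · refine ⟨by nlinarith [mul_self_nonneg (y 0)], fun h => hz ?_ ?_⟩
    · nlinarith [mul_self_nonneg (y 0)]
    · nlinarith [mul_self_nonneg (y 0)]
  · have hd : d = y 0 * x 0 := by linarith
    have hx0 : x 0 * x 0 = 1 + a := by linarith
    have h1 : y 0 * y 0 * (1 + a) ≤ b * a := by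
      calc y 0 * y 0 * (1 + a) = d * d := by rw [hd, ← hx0]; ring
        _ ≤ _ := cs
    have hy0 := mul_self_nonneg (y 0)
    have h2 : y 0 * y 0 ≤ b := by
      by_contra! h
      nlinarith [mul_le_mul_of_nonneg_right h.le ha]
    refine ⟨by linarith, fun h => ?_⟩
    have h3 : b = y 0 * y 0 := by linarith
    have h4 : y 0 * y 0 ≤ 0 := by rw [h3] at h1; linarith
    have h5 : y 0 = 0 := by nlinarith
    exact hz h5 (by rw [h3, h5]; ring)

end Bilinear

/-! ### Linear algebra of a tangent hyperplane and its unit normal -/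

section Normal

variable {ε : ℝ} {m : ℕ} {D : EuclideanSpace ℝ (Fin (m + 1)) →L[ℝ] Flat (m + 1) × ℝ}
  {x : Flat (m + 1)} {y : Flat (m + 1) × ℝ}

/-- A vector tangent to `ℚ_ε × ℝ` and orthogonal to the unit normal is tangent to the
hypersurface. -/
theorem mem_range_of_orthogonal (hε : ε = 1 ∨ ε = -1) (hD : Function.Injective D)
    (hx : flatMetric ε x x = ε) (hDx : ∀ v, flatMetric ε (D v).1 x = 0)
    (hyx : flatMetric ε y.1 x = 0) (hyD : ∀ v, prodMetric ε y (D v) = 0)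
    (hy : prodMetric ε y y = 1) {w : Flat (m + 1) × ℝ} (hwx : flatMetric ε w.1 x = 0)
    (hwy : prodMetric ε w y = 0) : ∃ v, D v = w := by
  have hε0 : ε ≠ 0 := by rcases hε with h | h <;> simp [h]
  -- The two orthogonality conditions form a map onto `ℝ × ℝ`, so its kernel has dimension `(m + 3)
  -- - 2 = m + 1`. This is also the dimension of the range of `D`, which lies in the kernel.
  let A : (Flat (m + 1) × ℝ) →ₗ[ℝ] ℝ × ℝ :=
    ((((flatB ε (m + 1)).flip x).comp (.fst ℝ _ _)).prod ((prodB ε (m + 1)).flip y)).toLinearMap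
  have hA : ∀ u, A u = (flatMetric ε u.1 x, prodMetric ε u y) := fun u => rfl
  have hsurj : Function.Surjective A := by
    rintro ⟨a, b⟩
    refine ⟨(a / ε) • (x, 0) + b • y, ?_⟩
    have h2 : prodMetric ε (x, (0 : ℝ)) y = 0 := by simp [prodMetric, flatMetric_comm x, hyx]
    rw [map_add, map_smul, map_smul, hA, hA, hx, h2, hyx, hy]
    simp [hε0]
  have hle : LinearMap.range D.toLinearMap ≤ LinearMap.ker A := by
    rintro _ ⟨v, rfl⟩
    rw [LinearMap.mem_ker, hA]
    exact Prod.ext (hDx v) ((prodMetric_comm _ _).trans (hyD v))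
  have h1 := LinearMap.finrank_range_add_finrank_ker A
  rw [LinearMap.range_eq_top.2 hsurj, finrank_top] at h1
  have h2 := LinearMap.finrank_range_of_inj (f := D.toLinearMap) hD
  simp at h1 h2
  have heq := Submodule.eq_of_le_of_finrank_eq hle (by omega)
  have : w ∈ LinearMap.range D.toLinearMap := by
    rw [heq, LinearMap.mem_ker, hA, hwx, hwy]; rfl
  exact this

/-- The remainder after subtracting the normal component is orthogonal to the range of `D`, to `(x,
0)` and to `y`. These span the ambient space, so nondegeneracy makes the remainder vanish. -/
theorem eq_smul_normal (hε : ε = 1 ∨ ε = -1) (hD : Function.Injective D)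
    (hx : flatMetric ε x x = ε) (hDx : ∀ v, flatMetric ε (D v).1 x = 0)
    (hyx : flatMetric ε y.1 x = 0) (hyD : ∀ v, prodMetric ε y (D v) = 0)
    (hy : prodMetric ε y y = 1) {w : Flat (m + 1) × ℝ} (hwx : flatMetric ε w.1 x = 0)
    (hwD : ∀ v, prodMetric ε w (D v) = 0) : w = prodMetric ε w y • y := by
  have hε2 : ε * ε = 1 := by rcases hε with h | h <;> simp [h]
  set r := w - prodMetric ε w y • y with hr
  have hry : prodMetric ε r y = 0 := by
    rw [hr, prodMetric_sub_left, prodMetric_smul_left, hy]; ring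
  have hrx : flatMetric ε r.1 x = 0 := by
    simp [hr, ← flatB_apply] at hwx hyx ⊢; simp [hwx, hyx]
  have hrD : ∀ v, prodMetric ε r (D v) = 0 := fun v => by
    rw [hr, prodMetric_sub_left, prodMetric_smul_left, hwD, hyD]; ring
  have : r = 0 := by
    refine eq_zero_of_prodMetric_eq_zero hε fun u => ?_
    set q := u - (ε * flatMetric ε u.1 x) • (x, (0 : ℝ)) - prodMetric ε u y • y with hq
    have hxy : prodMetric ε (x, (0 : ℝ)) y = 0 := by simp [prodMetric, flatMetric_comm x, hyx]
    obtain ⟨v, hv⟩ := mem_range_of_orthogonal hε hD hx hDx hyx hyD hy (w := q)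
      (by simp [hq, ← flatB_apply] at hx hyx ⊢; rw [hx, hyx]; linear_combination
            (-(flatB ε (m + 1) u.1 x)) * hε2)
      (by rw [hq, prodMetric_sub_left, prodMetric_sub_left, prodMetric_smul_left,
            prodMetric_smul_left, hxy, hy]; ring)
    have hu : u = q + (ε * flatMetric ε u.1 x) • (x, (0 : ℝ)) + prodMetric ε u y • y := by
      rw [hq]; abel
    rw [hu, prodMetric_add_right, prodMetric_add_right, prodMetric_smul_right,
      prodMetric_smul_right, hry, ← hv, hrD]
    have : prodMetric ε r (x, (0 : ℝ)) = 0 := by simp [prodMetric, hrx]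
    rw [this]; ring
  rw [hr, sub_eq_zero] at this
  exact this

end Normal

/-! ### Flow boxes from the inverse function theorem -/

section FlowBox

variable {m : ℕ} {W : Type*} [NormedAddCommGroup W] [NormedSpace ℝ W] [FiniteDimensional ℝ W]

/-- If an injective linear map into `W × ℝ` hits `(0, 1)`, then projecting `W` suitably to
`ℝ^m` keeps it injective. -/
theorem exists_projection_injective
    {D : EuclideanSpace ℝ (Fin (m + 1)) →L[ℝ] W × ℝ} (hD : Function.Injective D)
    {X : EuclideanSpace ℝ (Fin (m + 1))} (hX : D X = (0, 1)) :
    ∃ L : W →L[ℝ] EuclideanSpace ℝ (Fin m),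
      Function.Injective ((L.prodMap (.id ℝ ℝ)).comp D) := by
  let D₁ : EuclideanSpace ℝ (Fin (m + 1)) →ₗ[ℝ] W := ((ContinuousLinearMap.fst ℝ W ℝ).comp D)
  have hD₁ : ∀ v, D₁ v = (D v).1 := fun v => rfl
  have hker : ∀ v, D₁ v = 0 → v = (D v).2 • X := fun v hv => hD <| by
    rw [map_smul, hX]; exact Prod.ext ((show (D v).1 = 0 from hv).trans (by simp)) (by simp)
  have hX0 : X ≠ 0 := by rintro rfl; simpa using congrArg Prod.snd hX
  -- The first component of `D` loses exactly the line of `X`, so its range has dimension `m`; `L`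
  -- extends an isomorphism of that range with `ℝ^m`.
  have hspan : LinearMap.ker D₁ = Submodule.span ℝ {X} := by
    refine le_antisymm (fun v hv => ?_) ?_
    · rw [hker v hv]; exact Submodule.smul_mem _ _ (Submodule.mem_span_singleton_self X)
    · rw [Submodule.span_singleton_le_iff_mem, LinearMap.mem_ker, hD₁, hX]
  have hrank := LinearMap.finrank_range_add_finrank_ker D₁
  rw [hspan, finrank_span_singleton hX0, finrank_euclideanSpace_fin] at hrank
  let i : LinearMap.range D₁ ≃ₗ[ℝ] EuclideanSpace ℝ (Fin m) :=
    LinearEquiv.ofFinrankEq _ _ (by rw [finrank_euclideanSpace_fin]; omega)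
  obtain ⟨L, hL⟩ := LinearMap.exists_extend i.toLinearMap
  refine ⟨LinearMap.toContinuousLinearMap L, ?_⟩
  rw [injective_iff_map_eq_zero]
  intro v hv
  have h1 : L (D₁ v) = 0 := congrArg Prod.fst hv
  have h2 : (D v).2 = 0 := congrArg Prod.snd hv
  have h3 : i ⟨D₁ v, LinearMap.mem_range_self D₁ v⟩ = 0 := by
    rw [← h1]; exact (LinearMap.congr_fun hL ⟨D₁ v, LinearMap.mem_range_self D₁ v⟩).symm
  have h4 : D₁ v = 0 := by simpa using (i.map_eq_zero_iff).1 h3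
  rw [hker v h4, h2, zero_smul]

/-- Flow box: if `X` is a field of vectors that `Ψ` maps to `(0, 1)`, then suitable coordinates
`(L ∘ Ψ₁, Ψ₂)` straighten `X`. -/
theorem exists_flow_box {O : Set (EuclideanSpace ℝ (Fin (m + 1)))} (hO : IsOpen O)
    {Ψ : EuclideanSpace ℝ (Fin (m + 1)) → W × ℝ} (hΨ : ContDiffOn ℝ ∞ Ψ O)
    {z₀ : EuclideanSpace ℝ (Fin (m + 1))} (hz₀ : z₀ ∈ O)
    (hinj : Function.Injective (fderiv ℝ Ψ z₀))
    {X : EuclideanSpace ℝ (Fin (m + 1)) → EuclideanSpace ℝ (Fin (m + 1))}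
    (hX : ∀ z ∈ O, fderiv ℝ Ψ z (X z) = (0, 1)) :
    ∃ (L : W →L[ℝ] EuclideanSpace ℝ (Fin m))
      (e : OpenPartialHomeomorph (EuclideanSpace ℝ (Fin (m + 1)))
        (EuclideanSpace ℝ (Fin m) × ℝ)) (r : ℝ),
      0 < r ∧ z₀ ∈ e.source ∧ e.source ⊆ O ∧ (∀ z, e z = (L (Ψ z).1, (Ψ z).2)) ∧
      e.target = Metric.ball (L (Ψ z₀).1) r ×ˢ Set.Ioo ((Ψ z₀).2 - r) ((Ψ z₀).2 + r) ∧
      ContDiffOn ℝ ∞ e.symm e.target ∧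
      ∀ x s, (x, s) ∈ e.target →
        HasDerivAt (fun s => e.symm (x, s)) (X (e.symm (x, s))) s := by
  obtain ⟨L, hL⟩ := exists_projection_injective hinj (hX z₀ hz₀)
  set P := L.prodMap (.id ℝ ℝ) with hP
  have hPapp : ∀ w, P w = (L w.1, w.2) := fun w => rfl
  set G : EuclideanSpace ℝ (Fin (m + 1)) → EuclideanSpace ℝ (Fin m) × ℝ :=
    fun z => P (Ψ z) with hG
  have hGs : ContDiffOn ℝ ∞ G O := P.contDiff.comp_contDiffOn hΨ
  have hΨd : ∀ z ∈ O, HasFDerivAt Ψ (fderiv ℝ Ψ z) z := fun z hz =>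
    ((hΨ.contDiffAt (hO.mem_nhds hz)).differentiableAt (by simp)).hasFDerivAt
  have hGd : ∀ z ∈ O, HasFDerivAt G (P.comp (fderiv ℝ Ψ z)) z := fun z hz =>
    P.hasFDerivAt.comp z (hΨd z hz)
  have hfin : Module.finrank ℝ (EuclideanSpace ℝ (Fin (m + 1))) =
      Module.finrank ℝ (EuclideanSpace ℝ (Fin m) × ℝ) := by simp
  set A₀ : EuclideanSpace ℝ (Fin (m + 1)) ≃L[ℝ] EuclideanSpace ℝ (Fin m) × ℝ :=
    (LinearEquiv.ofInjectiveOfFinrankEq (P.comp (fderiv ℝ Ψ z₀)).toLinearMap hL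
      hfin).toContinuousLinearEquiv
  have hA₀ : (A₀ : EuclideanSpace ℝ (Fin (m + 1)) →L[ℝ] EuclideanSpace ℝ (Fin m) × ℝ) =
      P.comp (fderiv ℝ Ψ z₀) := by ext1 v; rfl
  have hGc : ContDiffAt ℝ ∞ G z₀ := hGs.contDiffAt (hO.mem_nhds hz₀)
  have hGd₀ : HasFDerivAt G
      (A₀ : EuclideanSpace ℝ (Fin (m + 1)) →L[ℝ] EuclideanSpace ℝ (Fin m) × ℝ) z₀ := by
    rw [hA₀]; exact hGd z₀ hz₀
  set e₀ := hGc.toOpenPartialHomeomorph G hGd₀ (by simp) with he₀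
  have he₀z : z₀ ∈ e₀.source := hGc.mem_toOpenPartialHomeomorph_source hGd₀ (by simp)
  -- the set where the derivative of `G` is invertible
  have hopen : IsOpen (O ∩ (fun z => fderiv ℝ G z) ⁻¹' Set.range
      ((↑) : (EuclideanSpace ℝ (Fin (m + 1)) ≃L[ℝ] EuclideanSpace ℝ (Fin m) × ℝ) → _)) :=
    (hGs.continuousOn_fderiv_of_isOpen hO (by simp)).isOpen_inter_preimage hO
      ContinuousLinearEquiv.isOpen
  set O' := O ∩ (fun z => fderiv ℝ G z) ⁻¹' Set.range
      ((↑) : (EuclideanSpace ℝ (Fin (m + 1)) ≃L[ℝ] EuclideanSpace ℝ (Fin m) × ℝ) → _) with hO'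
  have hz₀' : z₀ ∈ O' := ⟨hz₀, A₀, hGd₀.fderiv.symm⟩
  set e₁ := e₀.restrOpen O' hopen with he₁
  have hz₁ : z₀ ∈ e₁.source := ⟨he₀z, hz₀'⟩
  obtain ⟨r, hr, hball⟩ := Metric.isOpen_iff.1 e₁.open_target _ (e₁.map_source hz₁)
  set S := Metric.ball (L (Ψ z₀).1) r ×ˢ Set.Ioo ((Ψ z₀).2 - r) ((Ψ z₀).2 + r) with hS
  have hSo : IsOpen S := Metric.isOpen_ball.prod isOpen_Ioo
  have hST : S ⊆ e₁.target := by
    rw [hS, ← Real.ball_eq_Ioo, ball_prod_same]; exact hball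
  have hfin' : ∀ z ∈ O', ∃ A : EuclideanSpace ℝ (Fin (m + 1)) ≃L[ℝ]
      EuclideanSpace ℝ (Fin m) × ℝ, HasFDerivAt G (A : EuclideanSpace ℝ (Fin (m + 1)) →L[ℝ] _) z ∧
        A (X z) = (0, 1) := by
    rintro z ⟨hz, A, hA⟩
    have hA' : (A : EuclideanSpace ℝ (Fin (m + 1)) →L[ℝ] _) = P.comp (fderiv ℝ Ψ z) :=
      hA.trans (hGd z hz).fderiv
    refine ⟨A, hA' ▸ hGd z hz, ?_⟩
    have : A (X z) = (P.comp (fderiv ℝ Ψ z)) (X z) := by rw [← hA']; rfl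
    rw [this, ContinuousLinearMap.comp_apply, hX z hz, hPapp, map_zero]
  -- Restricting the inverse rather than the map makes the target exactly the box `S`.
  set e := (e₁.symm.restrOpen S hSo).symm with he
  have htarget : e.target = S := Set.inter_eq_right.2 hST
  have hmem : ∀ y ∈ e.target, e.symm y ∈ O' ∧ y ∈ e₁.target := fun y hy => by
    rw [htarget] at hy
    exact ⟨(e₁.map_target (hST hy)).2, hST hy⟩
  refine ⟨L, e, r, hr, ?_, ?_, fun z => rfl, htarget, ?_, ?_⟩
  · have : G z₀ ∈ S := by
      simp only [hS, hG, hPapp]; exact ⟨Metric.mem_ball_self hr, by constructor <;> linarith⟩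
    have h2 := e.map_target (htarget ▸ this)
    have h3 : e.symm (G z₀) = z₀ := e₁.left_inv hz₁
    rwa [h3] at h2
  · intro z hz
    have := (hmem _ (e.map_source hz)).1.1
    rwa [e.left_inv hz] at this
  · intro y hy
    obtain ⟨h1, h2⟩ := hmem y hy
    obtain ⟨A, hA, -⟩ := hfin' _ h1
    exact (e.contDiffAt_symm hy hA (hGs.contDiffAt (hO.mem_nhds h1.1))).contDiffWithinAt
  · intro x s hy
    obtain ⟨h1, h2⟩ := hmem _ hy
    obtain ⟨A, hA, hAX⟩ := hfin' _ h1
    -- The derivative of `G` sends `X` to `(0, 1)`, so that of the inverse sends `(0, 1)` to `X`: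
    -- the coordinate lines are integral curves.
    have h3 : HasFDerivAt e.symm (A.symm : _ →L[ℝ] EuclideanSpace ℝ (Fin (m + 1))) (x, s) :=
      e.hasFDerivAt_symm hy hA
    have h4 : HasDerivAt (fun s : ℝ => (x, s)) ((0 : EuclideanSpace ℝ (Fin m)), (1 : ℝ)) s :=
      (hasDerivAt_const s x).prodMk (hasDerivAt_id s)
    have h5 := h3.comp_hasDerivAt s h4
    rwa [← hAX, ContinuousLinearEquiv.coe_coe, A.symm_apply_apply] at h5

/-- A function that is constant in the direction of `X` is constant along the lines of a flow box
of `X`. -/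
theorem eq_of_fderiv_apply_eq_zero {E V Z : Type*} [NormedAddCommGroup E] [NormedSpace ℝ E]
    [NormedAddCommGroup Z] [NormedSpace ℝ Z] {h : V × ℝ → E} {u : E → Z} {X : E → E}
    {x : V} {a b : ℝ}
    (hh : ∀ s ∈ Set.Ioo a b, HasDerivAt (fun s => h (x, s)) (X (h (x, s))) s)
    (hu : ∀ s ∈ Set.Ioo a b, DifferentiableAt ℝ u (h (x, s)) ∧
      fderiv ℝ u (h (x, s)) (X (h (x, s))) = 0)
    {s s' : ℝ} (hs : s ∈ Set.Ioo a b) (hs' : s' ∈ Set.Ioo a b) :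
    u (h (x, s)) = u (h (x, s')) := by
  have hd : ∀ s ∈ Set.Ioo a b, HasDerivAt (fun s => u (h (x, s))) 0 s := fun s hs => by
    rw [← (hu s hs).2]
    exact (hu s hs).1.hasFDerivAt.comp_hasDerivAt s (hh s hs)
  exact isOpen_Ioo.is_const_of_deriv_eq_zero isPreconnected_Ioo
    (fun s hs => (hd s hs).differentiableAt.differentiableWithinAt)
    (fun s hs => (hd s hs).deriv) hs hs'

end FlowBox

/-! ### Hypersurfaces read in charts -/

/-- A hypersurface of `ℚ_ε^(m+1) × ℝ` parametrized by an open set `O` of `ℝ^(m+1)`, together with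
a choice `η` of unit normal vectors. -/
structure IsLocalHypersurface (ε : ℝ) (m : ℕ) (O : Set (EuclideanSpace ℝ (Fin (m + 1))))
    (F η : EuclideanSpace ℝ (Fin (m + 1)) → Flat (m + 1) × ℝ) : Prop where
  isOpen : IsOpen O
  smooth : ContDiffOn ℝ ∞ F O
  mem : ∀ z ∈ O, (F z).1 ∈ quadric ε (m + 1)
  injective : ∀ z ∈ O, Function.Injective (fderiv ℝ F z)
  tangent : ∀ z ∈ O, flatMetric ε (η z).1 (F z).1 = 0
  normal : ∀ z ∈ O, ∀ v, prodMetric ε (η z) (fderiv ℝ F z v) = 0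
  unit : ∀ z ∈ O, prodMetric ε (η z) (η z) = 1

section Charts

variable {k : ℕ} {M : Type*} [TopologicalSpace M] [ChartedSpace (EuclideanSpace ℝ (Fin k)) M]
  [IsManifold (𝓡 k) ∞ M] {V : Type*} [NormedAddCommGroup V] [NormedSpace ℝ V]

theorem contDiffOn_comp_chartAt_symm {f : M → V} (hf : ContMDiff (𝓡 k) 𝓘(ℝ, V) ∞ f) (p : M) :
    ContDiffOn ℝ ∞ (f ∘ (chartAt (EuclideanSpace ℝ (Fin k)) p).symm)
      (chartAt (EuclideanSpace ℝ (Fin k)) p).target :=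
  (hf.comp_contMDiffOn contMDiffOn_chart_symm).contDiffOn

theorem fderiv_comp_chartAt_symm {f : M → V} (hf : ContMDiff (𝓡 k) 𝓘(ℝ, V) ∞ f) (p : M)
    {z : EuclideanSpace ℝ (Fin k)} (hz : z ∈ (chartAt (EuclideanSpace ℝ (Fin k)) p).target)
    (v : EuclideanSpace ℝ (Fin k)) :
    fderiv ℝ (f ∘ (chartAt (EuclideanSpace ℝ (Fin k)) p).symm) z v =
      mfderiv (𝓡 k) 𝓘(ℝ, V) f ((chartAt (EuclideanSpace ℝ (Fin k)) p).symm z)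
        (mfderiv (𝓡 k) (𝓡 k) (chartAt (EuclideanSpace ℝ (Fin k)) p).symm z v) := by
  have hc := (mdifferentiable_chart (I := 𝓡 k) p).mdifferentiableAt_symm hz
  rw [← mfderiv_eq_fderiv, mfderiv_comp z (hf.mdifferentiable (by simp) _) hc]
  rfl

theorem injective_mfderiv_chartAt_symm (p : M)
    {z : EuclideanSpace ℝ (Fin k)} (hz : z ∈ (chartAt (EuclideanSpace ℝ (Fin k)) p).target) :
    Function.Injective (mfderiv (𝓡 k) (𝓡 k) (chartAt (EuclideanSpace ℝ (Fin k)) p).symm z) :=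
  (mdifferentiable_chart (I := 𝓡 k) p).symm.mfderiv_injective hz

end Charts

section

variable {ε : ℝ} {m : ℕ} {M : Type*} [TopologicalSpace M]
  [ChartedSpace (EuclideanSpace ℝ (Fin (m + 1))) M] [IsManifold (𝓡 (m + 1)) ∞ M]
  {f η : M → Flat (m + 1) × ℝ}

theorem IsHypersurface.isLocalHypersurface (hf : IsHypersurface ε m f)
    (hη : IsUnitNormal ε m f η) (p : M) :
    IsLocalHypersurface ε m (chartAt (EuclideanSpace ℝ (Fin (m + 1))) p).target
      (f ∘ (chartAt (EuclideanSpace ℝ (Fin (m + 1))) p).symm)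
      (η ∘ (chartAt (EuclideanSpace ℝ (Fin (m + 1))) p).symm) where
  isOpen := (chartAt _ p).open_target
  smooth := contDiffOn_comp_chartAt_symm hf.smooth p
  mem z _ := hf.mem _
  injective z hz v w hvw := by
    rw [fderiv_comp_chartAt_symm hf.smooth p hz, fderiv_comp_chartAt_symm hf.smooth p hz] at hvw
    exact injective_mfderiv_chartAt_symm p hz (hf.immersion _ hvw)
  tangent z _ := hη.tangent _
  normal z hz v := by
    rw [fderiv_comp_chartAt_symm hf.smooth p hz]
    exact hη.normal _ _
  unit z _ := hη.unit _

end

/-! ### Pointwise geometry of a parametrized hypersurface -/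

section LocalHypersurface

variable {ε : ℝ} {m : ℕ} {O : Set (EuclideanSpace ℝ (Fin (m + 1)))}
    {F η : EuclideanSpace ℝ (Fin (m + 1)) → Flat (m + 1) × ℝ}
    {z : EuclideanSpace ℝ (Fin (m + 1))}

theorem IsLocalHypersurface.hasFDerivAt (h : IsLocalHypersurface ε m O F η) (hz : z ∈ O) :
    HasFDerivAt F (fderiv ℝ F z) z :=
  ((h.smooth.contDiffAt (h.isOpen.mem_nhds hz)).differentiableAt (by simp)).hasFDerivAt

/-- Differentiate `⟨F₁, F₁⟩ = ε`. -/
theorem IsLocalHypersurface.position_orthogonal (h : IsLocalHypersurface ε m O F η)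
    (hz : z ∈ O) (v : EuclideanSpace ℝ (Fin (m + 1))) :
    flatMetric ε (fderiv ℝ F z v).1 (F z).1 = 0 := by
  have h1 := (h.hasFDerivAt hz).fst
  have h2 := (flatB ε (m + 1)).hasFDerivAt_of_bilinear h1 h1
  have h3 : HasFDerivAt (fun z => flatB ε (m + 1) (F z).1 (F z).1)
      (0 : EuclideanSpace ℝ (Fin (m + 1)) →L[ℝ] ℝ) z := by
    refine (hasFDerivAt_const ε z).congr_of_eventuallyEq ?_
    filter_upwards [h.isOpen.mem_nhds hz] with y hy using (h.mem y hy).1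
  have h4 := DFunLike.congr_fun (h2.unique h3) v
  simp [flatMetric_comm (F z).1] at h4
  exact h4

theorem IsLocalHypersurface.exists_fderiv_eq (h : IsLocalHypersurface ε m O F η)
    (hε : ε = 1 ∨ ε = -1) (hz : z ∈ O) {w : Flat (m + 1) × ℝ}
    (h1 : flatMetric ε w.1 (F z).1 = 0) (h2 : prodMetric ε w (η z) = 0) :
    ∃ v, fderiv ℝ F z v = w :=
  mem_range_of_orthogonal hε (h.injective z hz) (h.mem z hz).1 (h.position_orthogonal hz)
    (h.tangent z hz) (h.normal z hz) (h.unit z hz) h1 h2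

theorem IsLocalHypersurface.eq_smul (h : IsLocalHypersurface ε m O F η)
    (hε : ε = 1 ∨ ε = -1) (hz : z ∈ O) {w : Flat (m + 1) × ℝ}
    (h1 : flatMetric ε w.1 (F z).1 = 0) (h2 : ∀ v, prodMetric ε w (fderiv ℝ F z v) = 0) :
    w = prodMetric ε w (η z) • η z :=
  eq_smul_normal hε (h.injective z hz) (h.mem z hz).1 (h.position_orthogonal hz)
    (h.tangent z hz) (h.normal z hz) (h.unit z hz) h1 h2

theorem IsLocalHypersurface.flatMetric_normal_fst (h : IsLocalHypersurface ε m O F η)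
    (hz : z ∈ O) : flatMetric ε (η z).1 (η z).1 = 1 - (η z).2 ^ 2 := by
  have := h.unit z hz
  rw [prodMetric] at this
  linear_combination this

theorem IsLocalHypersurface.sq_le_one (h : IsLocalHypersurface ε m O F η)
    (hε : ε = 1 ∨ ε = -1) (hz : z ∈ O) : (η z).2 ^ 2 ≤ 1 := by
  have h1 := (flatMetric_self_nonneg_and_eq_zero hε (h.mem z hz).1 (h.tangent z hz)).1
  rw [h.flatMetric_normal_fst hz] at h1
  linarith

theorem IsLocalHypersurface.normal_fst_eq_zero (h : IsLocalHypersurface ε m O F η)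
    (hε : ε = 1 ∨ ε = -1) (hz : z ∈ O) (hν : (η z).2 ^ 2 = 1) : (η z).1 = 0 :=
  (flatMetric_self_nonneg_and_eq_zero hε (h.mem z hz).1 (h.tangent z hz)).2
    (by rw [h.flatMetric_normal_fst hz, hν, sub_self])

/-- If the normal is vertical, the cone over a neighbourhood in the hypersurface is a neighbourhood
in the flat space. -/
theorem IsLocalHypersurface.cone_mem_nhds (h : IsLocalHypersurface ε m O F η)
    (hε : ε = 1 ∨ ε = -1) (hz : z ∈ O) (hν : (η z).2 ^ 2 = 1)
    {A : Set (EuclideanSpace ℝ (Fin (m + 1)))} (hA : A ∈ nhds z) :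
    (fun q : EuclideanSpace ℝ (Fin (m + 1)) × ℝ => q.2 • (F q.1).1) '' (A ×ˢ Set.Ioi 0) ∈
      nhds (F z).1 := by
  have hε2 : ε * ε = 1 := by rcases hε with h | h <;> simp [h]
  have hη1 := h.normal_fst_eq_zero hε hz hν
  have hF : ContDiffAt ℝ ∞ (fun q : EuclideanSpace ℝ (Fin (m + 1)) × ℝ => q.2 • (F q.1).1)
      (z, 1) :=
    contDiffAt_snd.smul (contDiff_fst.contDiffAt.comp (z, (1 : ℝ))
      (ContDiffAt.comp (z, (1 : ℝ)) (h.smooth.contDiffAt (h.isOpen.mem_nhds hz)) contDiffAt_fst))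
  have h1 := (HasFDerivAt.comp (z, (1 : ℝ)) (h.hasFDerivAt hz) hasFDerivAt_fst).fst
  have h2 := (hasFDerivAt_snd (𝕜 := ℝ) (p := (z, (1 : ℝ)))).smul h1
  have h3 := hF.hasStrictFDerivAt' h2 (by simp)
  -- At `(z, 1)` the derivative is `(v, a) ↦ dF₁ v + a F₁`. Subtracting from `w` its radial part
  -- leaves a vector tangent to the quadric; placed at height `0` it is orthogonal to the vertical
  -- normal, hence lies in the range of `dF`.
  have h4 := h3.map_nhds_eq_of_surj (by
    rw [LinearMap.range_eq_top]
    intro w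
    set a := ε * flatMetric ε w (F z).1 with ha
    obtain ⟨v, hv⟩ := h.exists_fderiv_eq hε hz (w := (w - a • (F z).1, 0))
      (by
        have := (h.mem z hz).1
        simp only [← flatB_apply] at this ⊢
        simp only [map_sub, map_smul, sub_apply,
          smul_apply, this, smul_eq_mul, ha]
        rw [flatB_apply]
        linear_combination (-(flatMetric ε w (F z).1)) * hε2)
      (by simp [prodMetric, hη1, flatMetric])
    refine ⟨(v, a), ?_⟩
    simp [hv])
  have h5 : (A ×ˢ Set.Ioi (0 : ℝ)) ∈ nhds (z, (1 : ℝ)) :=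
    prod_mem_nhds hA (Ioi_mem_nhds one_pos)
  have h6 := Filter.image_mem_map (m := fun q : EuclideanSpace ℝ (Fin (m + 1)) × ℝ =>
    q.2 • (F q.1).1) h5
  rw [h4] at h6
  simpa using h6

end LocalHypersurface

/-! ### Vertical normal: open parts of slices -/

section Slice

variable {ε : ℝ} {m : ℕ} {M : Type*} [TopologicalSpace M] [ConnectedSpace M]
  [ChartedSpace (EuclideanSpace ℝ (Fin (m + 1))) M] [IsManifold (𝓡 (m + 1)) ∞ M]
  {f η : M → Flat (m + 1) × ℝ}

theorem eq_one_of_smul_mem_quadric (hε : ε = 1 ∨ ε = -1) {n : ℕ} {x : Flat n} {r : ℝ}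
    (hr : 0 < r) (hx : flatMetric ε x x = ε) (hrx : flatMetric ε (r • x) (r • x) = ε) :
    r = 1 := by
  rw [flatMetric_smul_left, flatMetric_smul_right, hx] at hrx
  have : r * r = 1 := by
    rcases hε with rfl | rfl
    · simpa using hrx
    · simpa using hrx
  nlinarith

/-- Orthogonality to a vertical normal says that the differential of the height vanishes, and
connectedness makes the height constant. Openness comes from the cone over a neighbourhood: one of
its points on the quadric must have radial factor `1`, so it already lies on the hypersurface. -/
theorem isOpenPartOfSlice_of_normal_vertical (hε : ε = 1 ∨ ε = -1) (hf : IsHypersurface ε m f)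
    (hη : IsUnitNormal ε m f η) (hν : ∀ p, (η p).2 ^ 2 = 1) : IsOpenPartOfSlice ε f := by
  have hconst : IsLocallyConstant fun p => (f p).2 := by
    rw [IsLocallyConstant.iff_eventually_eq]
    intro p
    have h := hf.isLocalHypersurface hη p
    set c := chartAt (EuclideanSpace ℝ (Fin (m + 1))) p
    have hp : c p ∈ c.target := c.map_source (mem_chart_source _ p)
    have hd : ∀ z ∈ c.target, HasFDerivAt (fun z => ((f ∘ c.symm) z).2)
        (0 : EuclideanSpace ℝ (Fin (m + 1)) →L[ℝ] ℝ) z := by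
      intro z hz
      have h1 := (h.hasFDerivAt hz).snd
      refine h1.congr_fderiv (ContinuousLinearMap.ext fun v => ?_)
      have h2 := h.normal z hz v
      have h3 : (η (c.symm z)).2 ≠ 0 := fun h0 => by
        have := hν (c.symm z)
        simp [h0] at this
      rw [prodMetric, h.normal_fst_eq_zero hε hz (hν _)] at h2
      simpa [flatMetric, h3] using h2
    obtain ⟨r, hr, hball⟩ := Metric.isOpen_iff.1 c.open_target _ hp
    have h1 : ∀ᶠ q in nhds p, q ∈ c.source ∧ c q ∈ Metric.ball (c p) r :=
      (c.open_source.eventually_mem (mem_chart_source _ p)).and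
        ((c.continuousAt (mem_chart_source _ p)).eventually_mem (Metric.ball_mem_nhds _ hr))
    filter_upwards [h1] with q hq
    have h2 := (convex_ball (c p) r).is_const_of_fderivWithin_eq_zero (𝕜 := ℝ)
      (f := fun z => ((f ∘ c.symm) z).2)
      (fun z hz => (hd z (hball hz)).differentiableAt.differentiableWithinAt)
      (fun z hz => by
        rw [fderivWithin_of_isOpen Metric.isOpen_ball hz, (hd z (hball hz)).fderiv])
      hq.2 (Metric.mem_ball_self hr)
    simpa [c.left_inv hq.1, c.left_inv (mem_chart_source _ p)] using h2
  obtain ⟨p₀⟩ : Nonempty M := inferInstance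
  refine ⟨(f p₀).2, fun W hW => ?_⟩
  have ht : ∀ p, (f p).2 = (f p₀).2 := fun p => hconst.apply_eq_of_preconnectedSpace p p₀
  have key : ∀ p ∈ W, ∃ U : Set (Flat (m + 1)), IsOpen U ∧ (f p).1 ∈ U ∧
      ∀ x ∈ U ∩ quadric ε (m + 1), ∃ q ∈ W, (f q).1 = x := by
    intro p hp
    have h := hf.isLocalHypersurface hη p
    set c := chartAt (EuclideanSpace ℝ (Fin (m + 1))) p
    have hps : p ∈ c.source := mem_chart_source _ p
    have hA : c.target ∩ c.symm ⁻¹' W ∈ nhds (c p) :=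
      (c.isOpen_inter_preimage_symm hW).mem_nhds
        ⟨c.map_source hps, by rwa [Set.mem_preimage, c.left_inv hps]⟩
    have h1 := h.cone_mem_nhds hε (c.map_source hps) (hν _) hA
    simp only [Function.comp_apply, c.left_inv hps] at h1
    obtain ⟨U, hUs, hU, hpU⟩ := mem_nhds_iff.1 h1
    refine ⟨U, hU, hpU, ?_⟩
    rintro x ⟨hxU, hx⟩
    obtain ⟨⟨z, r⟩, ⟨hz, hr⟩, rfl⟩ := hUs hxU
    have hr1 := eq_one_of_smul_mem_quadric hε hr (hf.mem (c.symm z)).1 hx.1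
    exact ⟨c.symm z, hz.2, by simp [show r = 1 from hr1]⟩
  choose! U hU hpU hUW using key
  refine ⟨⋃ p ∈ W, U p, isOpen_biUnion hU, Set.Subset.antisymm ?_ ?_⟩
  · rintro _ ⟨p, hp, rfl⟩
    exact ⟨⟨Set.mem_biUnion hp (hpU p hp), hf.mem p⟩, ht p⟩
  · rintro ⟨x, t⟩ ⟨⟨hx, hxQ⟩, rfl : t = _⟩
    obtain ⟨p, hp, hxp⟩ := Set.mem_iUnion₂.1 hx
    obtain ⟨q, hq, hqx⟩ := hUW p hp x ⟨hxp, hxQ⟩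
    exact ⟨q, hq, Prod.ext hqx (ht q)⟩

end Slice

/-! ### The functions `C_ε` and `S_ε` -/

section Trig

variable {ε : ℝ}

theorem contDiff_cosE : ContDiff ℝ ∞ (cosE ε) := by
  unfold cosE
  split_ifs
  · exact Real.contDiff_cos
  · exact Real.contDiff_cosh

theorem contDiff_sinE : ContDiff ℝ ∞ (sinE ε) := by
  unfold sinE
  split_ifs
  · exact Real.contDiff_sin
  · exact Real.contDiff_sinh

theorem hasDerivAt_cosE (hε : ε = 1 ∨ ε = -1) (s : ℝ) :
    HasDerivAt (cosE ε) (-(ε * sinE ε s)) s := by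
  rcases hε with rfl | rfl
  · have h1 : cosE 1 = Real.cos := by ext; simp [cosE]
    simpa [h1, sinE] using Real.hasDerivAt_cos s
  · have h1 : cosE (-1) = Real.cosh := by ext; simp [cosE]; norm_num
    have h2 : sinE (-1) = Real.sinh := by ext; simp [sinE]; norm_num
    simpa [h1, h2] using Real.hasDerivAt_cosh s

theorem hasDerivAt_sinE (hε : ε = 1 ∨ ε = -1) (s : ℝ) :
    HasDerivAt (sinE ε) (cosE ε s) s := by
  rcases hε with rfl | rfl
  · have h1 : sinE 1 = Real.sin := by ext; simp [sinE]
    simpa [h1, cosE] using Real.hasDerivAt_sin s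
  · have h1 : cosE (-1) = Real.cosh := by ext; simp [cosE]; norm_num
    have h2 : sinE (-1) = Real.sinh := by ext; simp [sinE]; norm_num
    simpa [h1, h2] using Real.hasDerivAt_sinh s

theorem cosE_sq_add_sinE_sq (hε : ε = 1 ∨ ε = -1) (s : ℝ) :
    cosE ε s ^ 2 + ε * sinE ε s ^ 2 = 1 := by
  rcases hε with rfl | rfl
  · simp [cosE, sinE]
  · have h1 : cosE (-1) = Real.cosh := by ext; simp [cosE]; norm_num
    have h2 : sinE (-1) = Real.sinh := by ext; simp [sinE]; norm_num
    rw [h1, h2]; linarith [Real.cosh_sq s]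

@[simp] theorem cosE_zero : cosE ε 0 = 1 := by simp [cosE]

@[simp] theorem sinE_zero : sinE ε 0 = 0 := by simp [sinE]

end Trig

/-! ### Smoothness of the normal and its derivative along the tangent part of `∂/∂t` -/

section Normal

variable {ε ν : ℝ} {m : ℕ} {O : Set (EuclideanSpace ℝ (Fin (m + 1)))}
    {F η : EuclideanSpace ℝ (Fin (m + 1)) → Flat (m + 1) × ℝ}
    {z : EuclideanSpace ℝ (Fin (m + 1))}

/-- A unit normal with constant nonzero vertical component is smooth. -/
theorem IsLocalHypersurface.contDiffOn_normal (h : IsLocalHypersurface ε m O F η)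
    (hε : ε = 1 ∨ ε = -1) (hν : ν ≠ 0) (hη : ∀ z ∈ O, (η z).2 = ν) : ContDiffOn ℝ ∞ η O := by
  let E := EuclideanSpace ℝ (Fin (m + 1))
  let P := Flat (m + 1) × ℝ
  -- `η z` is the unique solution of a square linear system with smooth coefficients: orthogonal to
  -- `dF`, orthogonal to the position, vertical component `ν`. Smoothness of operator inversion then
  -- passes to `η`.
  let A : E → P →L[ℝ] (E →L[ℝ] ℝ) × ℝ × ℝ := fun z =>
    (ContinuousLinearMap.inl ℝ (E →L[ℝ] ℝ) (ℝ × ℝ)).comp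
        (((ContinuousLinearMap.compL ℝ E P ℝ).flip (fderiv ℝ F z)).comp (prodB ε (m + 1))) +
      (ContinuousLinearMap.inr ℝ (E →L[ℝ] ℝ) (ℝ × ℝ)).comp
        ((ContinuousLinearMap.inl ℝ ℝ ℝ).comp
          (((flatB ε (m + 1)).flip (F z).1).comp (.fst ℝ _ _)) +
        (ContinuousLinearMap.inr ℝ ℝ ℝ).comp (.snd ℝ _ _))
  have hA : ∀ z w, A z w = ((prodB ε (m + 1) w).comp (fderiv ℝ F z),
      flatMetric ε w.1 (F z).1, w.2) := fun z w => by simp [A]; exact ⟨rfl, rfl⟩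
  have hAs : ContDiffOn ℝ ∞ A O := by
    have hF1 : ContDiffOn ℝ ∞ (fun z => (F z).1) O := contDiff_fst.comp_contDiffOn h.smooth
    have hF' : ContDiffOn ℝ ∞ (fderiv ℝ F) O := h.smooth.fderiv_of_isOpen h.isOpen (by simp)
    refine ContDiffOn.add ?_ (ContDiffOn.clm_comp contDiffOn_const (ContDiffOn.add ?_
      contDiffOn_const))
    · exact contDiffOn_const.clm_comp (((ContinuousLinearMap.contDiff _).comp_contDiffOn
        hF').clm_comp contDiffOn_const)
    · exact contDiffOn_const.clm_comp (((ContinuousLinearMap.contDiff _).comp_contDiffOn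
        hF1).clm_comp contDiffOn_const)
  have hAη : ∀ z ∈ O, A z (η z) = (0, 0, ν) := fun z hz => by
    rw [hA, h.tangent z hz, hη z hz]
    refine Prod.ext (ContinuousLinearMap.ext fun v => h.normal z hz v) rfl
  -- A kernel vector is a multiple of `η z` with zero vertical component, hence zero because `ν ≠
  -- 0`.
  have hinj : ∀ z ∈ O, Function.Injective (A z) := fun z hz => by
    rw [injective_iff_map_eq_zero]
    intro w hw
    rw [hA] at hw
    have h1 := h.eq_smul hε hz (w := w) (congrArg (fun q => q.2.1) hw)
      (fun v => DFunLike.congr_fun (congrArg Prod.fst hw) v)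
    have h2 : w.2 = 0 := congrArg (fun q => q.2.2) hw
    have h3 := congrArg Prod.snd h1
    rw [Prod.smul_snd, hη z hz, h2, smul_eq_mul, eq_comm, mul_eq_zero, or_iff_left hν] at h3
    rw [h1, h3, zero_smul]
  have hfin : Module.finrank ℝ P = Module.finrank ℝ ((E →L[ℝ] ℝ) × ℝ × ℝ) := by
    have : Module.finrank ℝ (E →L[ℝ] ℝ) = m + 1 := by
      rw [← (LinearMap.toContinuousLinearMap (𝕜 := ℝ) (E := E) (F' := ℝ)).finrank_eq,
        Module.finrank_linearMap]
      simp [E]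
    simp [P, this]
  have hinv : ∀ z ∈ O, (A z).IsInvertible := fun z hz =>
    ⟨(LinearEquiv.ofInjectiveOfFinrankEq (A z).toLinearMap (hinj z hz)
      hfin).toContinuousLinearEquiv, ContinuousLinearMap.ext fun v => rfl⟩
  have hη' : ∀ z ∈ O, η z = (A z).inverse (0, 0, ν) := fun z hz => by
    obtain ⟨B, hB⟩ := hinv z hz
    rw [← hAη z hz, ← hB, ContinuousLinearMap.inverse_equiv]
    exact (B.symm_apply_apply _).symm
  refine ContDiffOn.congr (fun z hz => ?_) hη'
  have h1 : ContDiffAt ℝ ∞ (fun z => (A z).inverse) z :=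
    ((hinv z hz).contDiffAt_map_inverse).comp z (hAs.contDiffAt (h.isOpen.mem_nhds hz))
  exact (h1.clm_apply contDiffAt_const).contDiffWithinAt

variable {c : ℝ} {X : EuclideanSpace ℝ (Fin (m + 1))}

/-- The lines of the tangent part of `∂/∂t` project to geodesics of `ℚ_ε`: the derivative of the
unit normal along them is parallel to the position vector. -/
theorem IsLocalHypersurface.fderiv_normal_apply (h : IsLocalHypersurface ε m O F η)
    (hε : ε = 1 ∨ ε = -1) (hs : ContDiffOn ℝ ∞ η O) (hη : ∀ z ∈ O, (η z).2 = ν)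
    (hz : z ∈ O) (_hc : 0 < c) (hcν : c ^ 2 = 1 - ν ^ 2)
    (hX : (fderiv ℝ F z X).1 = c⁻¹ • (η z).1) :
    fderiv ℝ η z X = -(ε * c) • ((F z).1, (0 : ℝ)) := by
  have hε2 : ε * ε = 1 := by rcases hε with h | h <;> simp [h]
  have hO := h.isOpen.mem_nhds hz
  have hdη : HasFDerivAt η (fderiv ℝ η z) z :=
    ((hs.contDiffAt hO).differentiableAt (by simp)).hasFDerivAt
  have hdF := h.hasFDerivAt hz
  have hdF' : HasFDerivAt (fderiv ℝ F) (fderiv ℝ (fderiv ℝ F) z) z :=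
    (((h.smooth.fderiv_of_isOpen h.isOpen (m := ∞) (by simp)).contDiffAt hO).differentiableAt
      (by simp)).hasFDerivAt
  have hηη : flatMetric ε (η z).1 (η z).1 = c ^ 2 := by
    rw [h.flatMetric_normal_fst hz, hη z hz, hcν]
  -- derivative of the vertical component
  have e2 : ∀ v, (fderiv ℝ η z v).2 = 0 := fun v => by
    have h1 : HasFDerivAt (fun z => (η z).2) (0 : EuclideanSpace ℝ (Fin (m + 1)) →L[ℝ] ℝ) z := by
      refine (hasFDerivAt_const ν z).congr_of_eventuallyEq ?_
      filter_upwards [hO] with y hy using hη y hy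
    exact DFunLike.congr_fun (hdη.snd.unique h1) v
  -- derivative of `⟨η, η⟩ = 1`
  have eu : ∀ v, prodMetric ε (fderiv ℝ η z v) (η z) = 0 := fun v => by
    have h1 : HasFDerivAt (fun z => prodB ε (m + 1) (η z) (η z))
        (0 : EuclideanSpace ℝ (Fin (m + 1)) →L[ℝ] ℝ) z := by
      refine (hasFDerivAt_const (1 : ℝ) z).congr_of_eventuallyEq ?_
      filter_upwards [hO] with y hy using h.unit y hy
    have h2 := DFunLike.congr_fun
      (((prodB ε (m + 1)).hasFDerivAt_of_bilinear hdη hdη).unique h1) v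
    simp [prodMetric_comm (η z)] at h2
    exact h2
  -- derivative of `⟨η, (F₁, 0)⟩ = 0`
  have et : ∀ v, flatMetric ε (fderiv ℝ η z v).1 (F z).1 =
      -flatMetric ε (η z).1 (fderiv ℝ F z v).1 := fun v => by
    have h1 : HasFDerivAt (fun z => flatB ε (m + 1) (η z).1 (F z).1)
        (0 : EuclideanSpace ℝ (Fin (m + 1)) →L[ℝ] ℝ) z := by
      refine (hasFDerivAt_const (0 : ℝ) z).congr_of_eventuallyEq ?_
      filter_upwards [hO] with y hy using h.tangent y hy
    have h2 := DFunLike.congr_fun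
      (((flatB ε (m + 1)).hasFDerivAt_of_bilinear hdη.fst hdF.fst).unique h1) v
    simp at h2
    linarith
  -- symmetry of the second fundamental form
  have es : ∀ v w, prodMetric ε (fderiv ℝ η z w) (fderiv ℝ F z v) =
      -prodMetric ε (η z) (fderiv ℝ (fderiv ℝ F) z w v) := fun v w => by
    have h1 : HasFDerivAt (fun z => prodB ε (m + 1) (η z) (fderiv ℝ F z v))
        (0 : EuclideanSpace ℝ (Fin (m + 1)) →L[ℝ] ℝ) z := by
      refine (hasFDerivAt_const (0 : ℝ) z).congr_of_eventuallyEq ?_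
      filter_upwards [hO] with y hy using h.normal y hy v
    have h2 := DFunLike.congr_fun (((prodB ε (m + 1)).hasFDerivAt_of_bilinear hdη
      (hdF'.clm_apply (hasFDerivAt_const v z))).unique h1) w
    simp at h2
    linarith
  have hsymm : IsSymmSndFDerivAt ℝ F z :=
    (h.smooth.contDiffAt hO).isSymmSndFDerivAt (by simp; exact WithTop.coe_le_coe.2 (le_top (a := (2 : ℕ∞))))
  -- The added multiple of the position makes the sum tangent to the quadric. It is then orthogonal
  -- to `dF`, hence a multiple of `η z`, and it is orthogonal to `η z` as well.
  have key : fderiv ℝ η z X + (ε * c) • ((F z).1, (0 : ℝ)) = 0 := by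
    have hw : ∀ u, prodMetric ε ((F z).1, (0 : ℝ)) u = flatMetric ε u.1 (F z).1 := fun u => by
      simp [prodMetric, flatMetric_comm (F z).1]
    have hη0 : prodMetric ε (fderiv ℝ η z X + (ε * c) • ((F z).1, (0 : ℝ))) (η z) = 0 := by
      rw [prodMetric_add_left, prodMetric_smul_left, hw, h.tangent z hz, eu]; ring
    rw [h.eq_smul hε hz (w := fderiv ℝ η z X + (ε * c) • ((F z).1, (0 : ℝ))) ?_ ?_, hη0,
      zero_smul]
    · rw [Prod.fst_add, Prod.smul_fst, flatMetric_add_left, flatMetric_smul_left, et, hX,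
        flatMetric_smul_right, hηη, (h.mem z hz).1]
      field_simp
      linear_combination c * hε2
    · intro v
      -- By symmetry this equals `⟨dη v, dF X⟩`. Since `dη v` has no vertical component and `dF X`
      -- has first component `c⁻¹ η₁`, it is `c⁻¹ ⟨dη v, η⟩ = 0`.
      have h1 : prodMetric ε (fderiv ℝ η z X) (fderiv ℝ F z v) = 0 := by
        rw [es, hsymm.eq, ← es, prodMetric, e2, hX, flatMetric_smul_right]
        have := eu v
        rw [prodMetric, e2] at this
        simp only [zero_mul, add_zero] at this ⊢
        rw [this, mul_zero]
      rw [prodMetric_add_left, prodMetric_smul_left, hw, h.position_orthogonal hz, h1]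
      ring
  rw [neg_smul]
  exact eq_neg_of_add_eq_zero_left key

end Normal

/-! ### Oblique normal: coordinates adapted to the parallel family -/

section ParallelFamily

variable {ε ν : ℝ} {m : ℕ} {O : Set (EuclideanSpace ℝ (Fin (m + 1)))}
    {F η : EuclideanSpace ℝ (Fin (m + 1)) → Flat (m + 1) × ℝ}
    {z₀ : EuclideanSpace ℝ (Fin (m + 1))}

/-- The box `ball × interval` in the target of a chart can be replaced by `ℝ^m × interval`. -/
theorem exists_openPartialHomeomorph_univ_prod {E : Type*} [NormedAddCommGroup E]
    [NormedSpace ℝ E] {e : OpenPartialHomeomorph E (EuclideanSpace ℝ (Fin m) × ℝ)}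
    {y : EuclideanSpace ℝ (Fin m)} {r : ℝ} (hr : 0 < r) {J : Set ℝ}
    (htarget : e.target = Metric.ball y r ×ˢ J)
    (he : ContDiffOn ℝ ∞ e e.source) (he' : ContDiffOn ℝ ∞ e.symm e.target) :
    ∃ (e₁ : OpenPartialHomeomorph E (EuclideanSpace ℝ (Fin m) × ℝ))
      (β : EuclideanSpace ℝ (Fin m) → EuclideanSpace ℝ (Fin m)),
      e₁.source = e.source ∧ e₁.target = Set.univ ×ˢ J ∧ ContDiff ℝ ∞ β ∧
      (∀ x, β x ∈ Metric.ball y r) ∧ (∀ x s, e₁.symm (x, s) = e.symm (β x, s)) ∧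
      ContDiffOn ℝ ∞ e₁ e₁.source ∧ ContDiffOn ℝ ∞ e₁.symm e₁.target := by
  set β := OpenPartialHomeomorph.univBall y r with hβ
  have hβmem : ∀ x, β x ∈ Metric.ball y r := fun x => by
    rw [← OpenPartialHomeomorph.univBall_target y hr]
    exact β.map_source (by rw [hβ, OpenPartialHomeomorph.univBall_source]; trivial)
  have hβs : ContDiff ℝ ∞ β := OpenPartialHomeomorph.contDiff_univBall
  set e₁ := ((β.prod (.refl ℝ)).trans e.symm).symm with he₁
  have hsource : e₁.source = e.source := by
    ext z
    simp only [he₁, OpenPartialHomeomorph.symm_source, OpenPartialHomeomorph.trans_target,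
      OpenPartialHomeomorph.symm_target, OpenPartialHomeomorph.symm_symm, Set.mem_inter_iff,
      OpenPartialHomeomorph.prod_target, hβ, OpenPartialHomeomorph.univBall_target y hr,
      and_iff_left_iff_imp]
    intro hz
    have := e.map_source hz
    rw [htarget] at this
    exact ⟨this.1, trivial⟩
  have htgt : e₁.target = Set.univ ×ˢ J := by
    ext ⟨x, s⟩
    have h1 : x ∈ β.source := by rw [hβ, OpenPartialHomeomorph.univBall_source]; trivial
    have h2 : (β x, s) ∈ e.target ↔ s ∈ J := by
      rw [htarget, Set.mem_prod]; exact and_iff_right (hβmem x)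
    simp [he₁, h1, h2]
  refine ⟨e₁, β, hsource, htgt, hβs, hβmem, fun x s => rfl, ?_, ?_⟩
  · have h1 : ContDiffOn ℝ ∞ (fun q : EuclideanSpace ℝ (Fin m) × ℝ => (β.symm q.1, q.2))
        e.target :=
      ContDiffOn.prodMk (OpenPartialHomeomorph.contDiffOn_univBall_symm.comp
        contDiff_fst.contDiffOn fun q hq => by rw [htarget] at hq; exact hq.1)
        contDiff_snd.contDiffOn
    rw [hsource]
    exact h1.comp he e.mapsTo
  · rw [htgt]
    exact he'.comp ((hβs.comp contDiff_fst).prodMk contDiff_snd).contDiffOn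
      fun q hq => by rw [htarget]; exact ⟨hβmem _, hq.2⟩

/-- In suitable coordinates, a hypersurface with constant angle function `ν ∈ (-1, 0)` is a
family of parallel hypersurfaces. -/
theorem IsLocalHypersurface.exists_parallel_coordinates (h : IsLocalHypersurface ε m O F η)
    (hε : ε = 1 ∨ ε = -1) (hν : ν < 0) (hν1 : ν ^ 2 < 1) (hη : ∀ z ∈ O, (η z).2 = ν)
    (hz₀ : z₀ ∈ O) :
    ∃ (e : OpenPartialHomeomorph (EuclideanSpace ℝ (Fin (m + 1)))
        (EuclideanSpace ℝ (Fin m) × ℝ)) (g N : EuclideanSpace ℝ (Fin m) → Flat (m + 1))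
      (b c B t₀ : ℝ), 0 < b ∧ 0 < B ∧ z₀ ∈ e.source ∧ e.source ⊆ O ∧
      e.target = Set.univ ×ˢ Set.Ioo (-b) b ∧
      ContDiffOn ℝ ∞ e e.source ∧ ContDiffOn ℝ ∞ e.symm e.target ∧
      ContDiff ℝ ∞ g ∧ ContDiff ℝ ∞ N ∧ c ≠ 0 ∧ c ^ 2 = 1 - ν ^ 2 ∧
      (∀ x, N x = c⁻¹ • (η (e.symm (x, 0))).1) ∧
      ∀ x, ∀ s ∈ Set.Ioo (-b) b, F (e.symm (x, s)) = (parallel ε g N s x, B * s + t₀) := by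
  set c := √(1 - ν ^ 2)
  have hc0 : 0 < c := Real.sqrt_pos.2 (by linarith)
  have hc2 : c ^ 2 = 1 - ν ^ 2 := Real.sq_sqrt (by linarith)
  -- This value makes `(c⁻¹ η₁, B)` orthogonal to `η`: the product is `c + B ν`.
  set B := c / (-ν) with hB
  have hB0 : 0 < B := div_pos hc0 (by linarith)
  set t₀ := (F z₀).2
  have hηs := h.contDiffOn_normal hε hν.ne hη
  set N : EuclideanSpace ℝ (Fin (m + 1)) → Flat (m + 1) := fun z => c⁻¹ • (η z).1 with hN
  set σ : EuclideanSpace ℝ (Fin (m + 1)) → ℝ := fun z => B⁻¹ • ((F z).2 - t₀) with hσ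
  -- `G` and `K` undo the rotation by `σ` of the pair `(F₁, N)`. As `σ` grows at unit rate along
  -- `X`, they are constant there, and they equal `F₁` and `N` where `σ = 0`.
  set G : EuclideanSpace ℝ (Fin (m + 1)) → Flat (m + 1) := fun z =>
    cosE ε (σ z) • (F z).1 - sinE ε (σ z) • N z with hG
  set K : EuclideanSpace ℝ (Fin (m + 1)) → Flat (m + 1) := fun z =>
    (ε * sinE ε (σ z)) • (F z).1 + cosE ε (σ z) • N z with hK
  have hF1s : ContDiffOn ℝ ∞ (fun z => (F z).1) O := contDiff_fst.comp_contDiffOn h.smooth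
  have hNs : ContDiffOn ℝ ∞ N O := (contDiff_fst.comp_contDiffOn hηs).const_smul _
  have hσs : ContDiffOn ℝ ∞ σ O :=
    ((contDiff_snd.comp_contDiffOn h.smooth).sub contDiffOn_const).const_smul _
  have hCs : ContDiffOn ℝ ∞ (fun z => cosE ε (σ z)) O := contDiff_cosE.comp_contDiffOn hσs
  have hSs : ContDiffOn ℝ ∞ (fun z => sinE ε (σ z)) O := contDiff_sinE.comp_contDiffOn hσs
  have hGs : ContDiffOn ℝ ∞ G O := (hCs.smul hF1s).sub (hSs.smul hNs)
  have hKs : ContDiffOn ℝ ∞ K O := ((contDiffOn_const.mul hSs).smul hF1s).add (hCs.smul hNs)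
  have hX : ∀ z ∈ O, ∃ X, fderiv ℝ F z X = (N z, B) := fun z hz => by
    refine h.exists_fderiv_eq hε hz ?_ ?_
    · simp only [hN, flatMetric_smul_left, h.tangent z hz, mul_zero]
    · simp only [prodMetric, hN, flatMetric_smul_left, h.flatMetric_normal_fst hz, hη z hz, ← hc2,
        hB]
      field_simp [hν.ne]
      ring
  choose! X hX using hX
  have hdN : ∀ z ∈ O, ∃ A : EuclideanSpace ℝ (Fin (m + 1)) →L[ℝ] Flat (m + 1),
      HasFDerivAt N A z ∧ A (X z) = -ε • (F z).1 := fun z hz => by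
    have hdη : HasFDerivAt η (fderiv ℝ η z) z :=
      ((hηs.contDiffAt (h.isOpen.mem_nhds hz)).differentiableAt (by simp)).hasFDerivAt
    refine ⟨_, hdη.fst.const_smul c⁻¹, ?_⟩
    have h1 := h.fderiv_normal_apply hε hηs hη hz hc0 hc2 (X := X z) (by rw [hX z hz])
    change c⁻¹ • (fderiv ℝ η z (X z)).1 = _
    rw [h1, Prod.smul_fst, smul_smul]
    congr 1
    field_simp
  have hdσ : ∀ z ∈ O, HasFDerivAt σ
      (B⁻¹ • (ContinuousLinearMap.snd ℝ (Flat (m + 1)) ℝ).comp (fderiv ℝ F z)) z := fun z hz =>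
    ((h.hasFDerivAt hz).snd.sub_const t₀).const_smul B⁻¹
  have hσX : ∀ z ∈ O, (B⁻¹ • (ContinuousLinearMap.snd ℝ (Flat (m + 1)) ℝ).comp (fderiv ℝ F z))
      (X z) = 1 := fun z hz => by
    change B⁻¹ • (fderiv ℝ F z (X z)).2 = 1
    rw [hX z hz]
    exact inv_mul_cancel₀ hB0.ne'
  have hσX' : ∀ z ∈ O, B⁻¹ • ((ContinuousLinearMap.snd ℝ (Flat (m + 1)) ℝ).comp (fderiv ℝ F z))
      (X z) = 1 := hσX
  have hdG : ∀ z ∈ O, fderiv ℝ (fun z => (G z, σ z)) z (X z) = (0, 1) := fun z hz => by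
    obtain ⟨A, hA, hAX⟩ := hdN z hz
    have h1 := (((hasDerivAt_cosE hε (σ z)).comp_hasFDerivAt z (hdσ z hz)).smul
      (h.hasFDerivAt hz).fst).sub
      (((hasDerivAt_sinE hε (σ z)).comp_hasFDerivAt z (hdσ z hz)).smul hA)
    have h2 := (h1.prodMk (hdσ z hz)).fderiv
    have h3 : ((ContinuousLinearMap.fst ℝ (Flat (m + 1)) ℝ).comp (fderiv ℝ F z)) (X z) = N z :=
      congrArg Prod.fst (hX z hz)
    refine (DFunLike.congr_fun h2 (X z)).trans (Prod.ext ?_ (hσX z hz))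
    simp only [ContinuousLinearMap.prod_apply, sub_apply, add_apply, smul_apply,
      ContinuousLinearMap.smulRight_apply, hAX, h3]
    rw [hσX' z hz]
    simp only [Function.comp_apply, smul_eq_mul]
    module
  have hdK : ∀ z ∈ O, fderiv ℝ K z (X z) = 0 := fun z hz => by
    obtain ⟨A, hA, hAX⟩ := hdN z hz
    have h1 := ((((hasDerivAt_sinE hε (σ z)).comp_hasFDerivAt z (hdσ z hz)).const_mul ε).smul
      (h.hasFDerivAt hz).fst).add
      (((hasDerivAt_cosE hε (σ z)).comp_hasFDerivAt z (hdσ z hz)).smul hA)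
    have h3 : ((ContinuousLinearMap.fst ℝ (Flat (m + 1)) ℝ).comp (fderiv ℝ F z)) (X z) = N z :=
      congrArg Prod.fst (hX z hz)
    refine (DFunLike.congr_fun h1.fderiv (X z)).trans ?_
    simp only [add_apply, smul_apply,
      ContinuousLinearMap.smulRight_apply, hAX, h3]
    rw [hσX' z hz]
    simp only [Function.comp_apply, smul_eq_mul]
    module
  have hσ0 : σ z₀ = 0 := by simp [hσ, t₀]
  -- If `dσ v = 0` then the height part of `dF v` vanishes; since `σ z₀ = 0`, `dG v` reduces to the
  -- first component of `dF v`.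
  have hinj : Function.Injective (fderiv ℝ (fun z => (G z, σ z)) z₀) := by
    obtain ⟨A, hA, hAX⟩ := hdN z₀ hz₀
    have h1 := (((hasDerivAt_cosE hε (σ z₀)).comp_hasFDerivAt z₀ (hdσ z₀ hz₀)).smul
      (h.hasFDerivAt hz₀).fst).sub
      (((hasDerivAt_sinE hε (σ z₀)).comp_hasFDerivAt z₀ (hdσ z₀ hz₀)).smul hA)
    have h2 := (h1.prodMk (hdσ z₀ hz₀)).fderiv
    rw [injective_iff_map_eq_zero]
    intro v hv
    have h3 := (DFunLike.congr_fun h2 v).symm.trans hv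
    have h4 : B⁻¹ • (fderiv ℝ F z₀ v).2 = 0 := congrArg Prod.snd h3
    have h5 : (fderiv ℝ F z₀ v).2 = 0 := by simpa [hB0.ne'] using h4
    have h6 := congrArg Prod.fst h3
    simp only [ContinuousLinearMap.prod_apply, sub_apply, add_apply, smul_apply,
      ContinuousLinearMap.smulRight_apply] at h6
    have h7 : (fderiv ℝ F z₀ v).1 = 0 := by simpa [hσ0, h5] using h6
    exact h.injective z₀ hz₀ ((Prod.ext h7 h5 : fderiv ℝ F z₀ v = 0).trans (map_zero _).symm)
  obtain ⟨L, e, r, hr, hze, heO, hee, htarget, hes, hline⟩ :=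
    exists_flow_box h.isOpen (hGs.prodMk hσs) hz₀ hinj hdG
  have hes' : ContDiffOn ℝ ∞ e e.source := by
    refine ((L.contDiff.comp_contDiffOn (hGs.mono heO)).prodMk (hσs.mono heO)).congr
      fun z _ => hee z
  simp only [hσ0, zero_sub, zero_add] at htarget
  obtain ⟨e₁, β, hsource, htarget₁, hβ, hβmem, he₁, hes₁, hes₁'⟩ :=
    exists_openPartialHomeomorph_univ_prod hr htarget hes' hes
  have hmem : ∀ x, ∀ s ∈ Set.Ioo (-r) r, e₁.symm (x, s) ∈ O ∧ (β x, s) ∈ e.target :=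
    fun x s hs => by
      have h1 : (β x, s) ∈ e.target := by rw [htarget]; exact ⟨hβmem x, hs⟩
      exact ⟨by rw [he₁]; exact heO (e.map_target h1), h1⟩
  have h0 : (0 : ℝ) ∈ Set.Ioo (-r) r := ⟨by linarith, hr⟩
  have hσe : ∀ x, ∀ s ∈ Set.Ioo (-r) r, σ (e₁.symm (x, s)) = s := fun x s hs => by
    have h1 := congrArg Prod.snd (e.right_inv (hmem x s hs).2)
    rw [hee] at h1
    rwa [he₁]
  have hconst : ∀ {u : EuclideanSpace ℝ (Fin (m + 1)) → Flat (m + 1)},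
      ContDiffOn ℝ ∞ u O → (∀ z ∈ O, fderiv ℝ u z (X z) = 0) →
      ∀ x, ∀ s ∈ Set.Ioo (-r) r, u (e₁.symm (x, s)) = u (e₁.symm (x, 0)) := by
    intro u hu hu' x s hs
    rw [he₁, he₁]
    refine eq_of_fderiv_apply_eq_zero (h := e.symm) (X := X) (a := -r) (b := r)
      (fun s hs => hline _ _ (hmem x s hs).2) (fun s hs => ?_) hs h0
    have h1 := (hmem x s hs).1
    rw [he₁] at h1
    exact ⟨(hu.contDiffAt (h.isOpen.mem_nhds h1)).differentiableAt (by simp), hu' _ h1⟩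
  have hdG' : ∀ z ∈ O, fderiv ℝ G z (X z) = 0 := fun z hz => by
    have h1 := DifferentiableAt.fderiv_prodMk (𝕜 := ℝ)
      ((hGs.contDiffAt (h.isOpen.mem_nhds hz)).differentiableAt (by simp))
      ((hσs.contDiffAt (h.isOpen.mem_nhds hz)).differentiableAt (by simp))
    exact congrArg Prod.fst ((DFunLike.congr_fun h1 (X z)).symm.trans (hdG z hz))
  have hslice : ContDiff ℝ ∞ fun x => e₁.symm (x, 0) := by
    rw [← contDiffOn_univ]
    exact hes₁'.comp (contDiff_id.prodMk contDiff_const).contDiffOn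
      fun x _ => by rw [htarget₁]; exact ⟨trivial, h0⟩
  refine ⟨e₁, fun x => (F (e₁.symm (x, 0))).1, fun x => N (e₁.symm (x, 0)), r, c, B, t₀, hr, hB0,
    hsource ▸ hze, hsource ▸ heO, htarget₁, hes₁, hes₁', ?_, ?_, hc0.ne', hc2, fun x => rfl, ?_⟩
  · rw [← contDiffOn_univ]
    exact hF1s.comp hslice.contDiffOn fun x _ => (hmem x 0 h0).1
  · rw [← contDiffOn_univ]
    exact hNs.comp hslice.contDiffOn fun x _ => (hmem x 0 h0).1
  · intro x s hs
    have h1 : G (e₁.symm (x, s)) = (F (e₁.symm (x, 0))).1 := by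
      rw [hconst hGs hdG' x s hs]
      simp [hG, hσe x 0 h0]
    have h2 : K (e₁.symm (x, s)) = N (e₁.symm (x, 0)) := by
      rw [hconst hKs hdK x s hs]
      simp [hK, hσe x 0 h0]
    have h3 := hσe x s hs
    refine Prod.ext ?_ ?_
    · simp only [parallel, ← h1, ← h2, hG, hK, h3]
      -- Rotating back: `C_ε G + S_ε K = (C_ε² + ε S_ε²) F₁ = F₁`.
      have h4 := cosE_sq_add_sinE_sq hε s
      have h5 : (F (e₁.symm (x, s))).1 =
        (cosE ε s ^ 2 + ε * sinE ε s ^ 2) • (F (e₁.symm (x, s))).1 := by rw [h4, one_smul]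
      refine h5.trans ?_
      module
    · simp only [hσ, smul_eq_mul] at h3
      field_simp at h3
      change _ = B * s + t₀
      linarith

end ParallelFamily

/-! ### Oblique normal: transfer to the manifold -/

section

variable {ε ν : ℝ} {m : ℕ} {M : Type*} [TopologicalSpace M]
  [ChartedSpace (EuclideanSpace ℝ (Fin (m + 1))) M] [IsManifold (𝓡 (m + 1)) ∞ M]
  {f η : M → Flat (m + 1) × ℝ}

theorem contMDiffOn_prod_model_iff {E E' : Type*} [NormedAddCommGroup E] [NormedSpace ℝ E]
    [NormedAddCommGroup E'] [NormedSpace ℝ E'] {u : E → E' × ℝ} {s : Set E} :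
    ContMDiffOn 𝓘(ℝ, E) (𝓘(ℝ, E').prod 𝓘(ℝ, ℝ)) ∞ u s ↔ ContDiffOn ℝ ∞ u s := by
  rw [← contMDiffOn_iff_contDiffOn, modelWithCornersSelf_prod, ← chartedSpaceSelf_prod]

theorem contMDiffOn_prod_model_iff' {E E' : Type*} [NormedAddCommGroup E] [NormedSpace ℝ E]
    [NormedAddCommGroup E'] [NormedSpace ℝ E'] {u : E' × ℝ → E} {s : Set (E' × ℝ)} :
    ContMDiffOn (𝓘(ℝ, E').prod 𝓘(ℝ, ℝ)) 𝓘(ℝ, E) ∞ u s ↔ ContDiffOn ℝ ∞ u s := by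
  rw [← contMDiffOn_iff_contDiffOn, modelWithCornersSelf_prod, ← chartedSpaceSelf_prod]

/-- Composing a chart of `M` with a smooth change of coordinates to `ℝ^m × ℝ` gives a partial
diffeomorphism. -/
theorem exists_partialDiffeomorph_of_chart (p : M)
    {e : OpenPartialHomeomorph (EuclideanSpace ℝ (Fin (m + 1))) (EuclideanSpace ℝ (Fin m) × ℝ)}
    (hsource : e.source ⊆ (chartAt (EuclideanSpace ℝ (Fin (m + 1))) p).target)
    (he : ContDiffOn ℝ ∞ e e.source) (he' : ContDiffOn ℝ ∞ e.symm e.target) :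
    ∃ φ : PartialDiffeomorph ((𝓡 m).prod 𝓘(ℝ, ℝ)) (𝓡 (m + 1)) (EuclideanSpace ℝ (Fin m) × ℝ) M ∞,
      φ.toPartialEquiv =
        ((chartAt (EuclideanSpace ℝ (Fin (m + 1))) p).trans e).toPartialEquiv.symm ∧
      φ.source = e.target := by
  set c := chartAt (EuclideanSpace ℝ (Fin (m + 1))) p
  have htarget : (c.trans e).target = e.target := by
    rw [OpenPartialHomeomorph.trans_target]
    exact Set.inter_eq_left.2 fun q hq => hsource (e.map_target hq)
  refine ⟨⟨(c.trans e).toPartialEquiv.symm, (c.trans e).open_target, (c.trans e).open_source,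
    ?_, ?_⟩, rfl, htarget⟩
  · change ContMDiffOn _ _ ∞ (c.symm ∘ e.symm) (c.trans e).target
    rw [htarget]
    exact contMDiffOn_chart_symm.comp (contMDiffOn_prod_model_iff'.2 he')
      fun q hq => hsource (e.map_target hq)
  · change ContMDiffOn _ _ ∞ (e ∘ c) (c.trans e).source
    rw [OpenPartialHomeomorph.trans_source]
    exact (contMDiffOn_prod_model_iff.2 he).comp
      (contMDiffOn_chart.mono Set.inter_subset_left) fun q hq => hq.2

theorem isParallelFamilyNear_of_neg (hε : ε = 1 ∨ ε = -1) (hf : IsHypersurface ε m f)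
    (hη : IsUnitNormal ε m f η) (hν : ν < 0) (hν1 : ν ^ 2 < 1) (hην : ∀ p, (η p).2 = ν) (p : M) :
    IsParallelFamilyNear ε m f p := by
  have h := hf.isLocalHypersurface hη p
  have hps := mem_chart_source (EuclideanSpace ℝ (Fin (m + 1))) p
  set ch := chartAt (EuclideanSpace ℝ (Fin (m + 1))) p
  obtain ⟨e, g, N, b, c, B, t₀, hb, hB, hpe, hsource, htarget, he, he', hg, hN, hc, hc2, hNη,
    hF⟩ := h.exists_parallel_coordinates hε hν hν1 (fun z _ => hην _) (ch.map_source hps)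
  set F := f ∘ ch.symm
  have h0 : (0 : ℝ) ∈ Set.Ioo (-b) b := ⟨by linarith, hb⟩
  have hg0 : parallel ε g N 0 = g := by ext1 x; simp [parallel]
  have hgF : ∀ x, F (e.symm (x, 0)) = (g x, t₀) := fun x => by
    rw [hF x 0 h0, hg0]; simp
  have hmem : ∀ x, ∀ s ∈ Set.Ioo (-b) b, (x, s) ∈ e.target ∧ e.symm (x, s) ∈ ch.target :=
    fun x s hs => by
      have h1 : (x, s) ∈ e.target := by rw [htarget]; exact ⟨trivial, hs⟩
      exact ⟨h1, hsource (e.map_target h1)⟩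
  -- On the slice of parameter `s` the height is constant, so `F` restricts to `(g_s, const)`. This
  -- yields both the immersivity of `g_s` and, at `s = 0`, the normality of `N` to `g`.
  have hder : ∀ x, ∀ s ∈ Set.Ioo (-b) b,
      ∃ K : EuclideanSpace ℝ (Fin m) →L[ℝ] EuclideanSpace ℝ (Fin (m + 1)), Function.Injective K ∧
        ∀ v, fderiv ℝ F (e.symm (x, s)) (K v) = (fderiv ℝ (parallel ε g N s) x v, 0) := by
    intro x s hs
    have hx := hmem x s hs
    have hds : HasFDerivAt e.symm (fderiv ℝ e.symm (x, s)) (x, s) :=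
      ((he'.contDiffAt (e.open_target.mem_nhds hx.1)).differentiableAt (by simp)).hasFDerivAt
    have hd : HasFDerivAt e (fderiv ℝ e (e.symm (x, s))) (e.symm (x, s)) :=
      ((he.contDiffAt (e.open_source.mem_nhds (e.map_target hx.1))).differentiableAt
        (by simp)).hasFDerivAt
    have hi : HasFDerivAt (fun y : EuclideanSpace ℝ (Fin m) => (y, s))
        (ContinuousLinearMap.inl ℝ _ ℝ) x := hasFDerivAt_prodMk_left x s
    have hk := HasFDerivAt.comp x (g := e.symm) hds hi
    have hek := HasFDerivAt.comp x (g := e) hd hk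
    have hek' := hi.congr_of_eventuallyEq (f₁ := e ∘ e.symm ∘ fun y => (y, s))
      (Filter.Eventually.of_forall fun y => e.right_inv (hmem y s hs).1)
    have huniq := hek.unique hek'
    refine ⟨(fderiv ℝ e.symm (x, s)).comp (ContinuousLinearMap.inl ℝ _ ℝ), fun v w hvw => ?_,
      fun v => ?_⟩
    · have h1 := DFunLike.congr_fun huniq v
      have h2 := DFunLike.congr_fun huniq w
      have h3 : (v, (0 : ℝ)) = (w, 0) := h1.symm.trans ((congrArg _ hvw).trans h2)
      exact congrArg Prod.fst h3
    · have hpar : HasFDerivAt (parallel ε g N s) (fderiv ℝ (parallel ε g N s) x) x := by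
        have : ContDiff ℝ ∞ (parallel ε g N s) :=
          (hg.const_smul (cosE ε s)).add (hN.const_smul (sinE ε s))
        exact (this.differentiable (by simp) x).hasFDerivAt
      have h1 := HasFDerivAt.comp x (g := F) (h.hasFDerivAt hx.2) hk
      have h2 := (hpar.prodMk (hasFDerivAt_const (B * s + t₀) x)).congr_of_eventuallyEq
        (f₁ := F ∘ e.symm ∘ fun y => (y, s)) (Filter.Eventually.of_forall fun y => hF y s hs)
      exact DFunLike.congr_fun (h1.unique h2) v
  have himm : ∀ s ∈ Set.Ioo (-b) b, ∀ x,
      Function.Injective (mfderiv (𝓡 m) 𝓘(ℝ, Flat (m + 1)) (parallel ε g N s) x) := by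
    intro s hs x
    rw [mfderiv_eq_fderiv]
    obtain ⟨K, hK, hFK⟩ := hder x s hs
    intro v w hvw
    exact hK (h.injective _ (hmem x s hs).2
      ((hFK v).trans ((congrArg (·, (0 : ℝ)) hvw).trans (hFK w).symm)))
  obtain ⟨φ, hφ, hφs⟩ := exists_partialDiffeomorph_of_chart p hsource he he'
  have hφapp : ∀ q, φ q = ch.symm (e.symm q) := fun q => by
    rw [hφ]; rfl
  refine ⟨EuclideanSpace ℝ (Fin m), inferInstance, inferInstance, inferInstance, inferInstance,
    inferInstance, g, N, Set.univ, -b, b, B, t₀, φ, ⟨hg.contMDiff, fun x => ?_, fun x => ?_⟩,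
    ⟨hN.contMDiff, fun x => ?_, fun x v => ?_, fun x => ?_⟩, isOpen_univ, by linarith, hb, hB,
    fun s hs x _ => himm s hs x, hφs.trans htarget, ?_, fun x _ s hs => ?_⟩
  · have := h.mem _ (hmem x 0 h0).2
    rwa [hgF] at this
  · have := himm 0 h0 x
    rwa [hg0] at this
  · have := h.tangent _ (hmem x 0 h0).2
    rw [hgF] at this
    rw [hNη, flatMetric_smul_left, this, mul_zero]
  · obtain ⟨K, -, hFK⟩ := hder x 0 h0
    have h1 := (congrArg (prodMetric ε _) (hFK v)).symm.trans (h.normal _ (hmem x 0 h0).2 (K v))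
    rw [hg0, prodMetric, mul_zero, add_zero] at h1
    rw [mfderiv_eq_fderiv, hNη]
    exact (flatMetric_smul_left _ _ _).trans (mul_eq_zero_of_right _ h1)
  · rw [hNη, flatMetric_smul_left, flatMetric_smul_right,
      h.flatMetric_normal_fst (hmem x 0 h0).2, show ((η ∘ ch.symm) (e.symm (x, 0))).2 = ν from
        hην _, ← hc2]
    field_simp
  · rw [show φ.target = (ch.trans e).source by rw [hφ]; rfl]
    rw [OpenPartialHomeomorph.trans_source]
    exact ⟨hps, hpe⟩
  · rw [hφapp]
    refine (hF x s hs).trans ?_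
    simp [dt]

/-- Passing from `η` to `-η` reverses the sign of `ν`, so the case `ν < 0`, in which `c / (-ν)` is
positive, suffices. -/
theorem isParallelFamilyNear (hε : ε = 1 ∨ ε = -1) (hf : IsHypersurface ε m f)
    (hη : IsUnitNormal ε m f η) (hν : ν ≠ 0) (hν1 : ν ^ 2 < 1) (hην : ∀ p, (η p).2 = ν) (p : M) :
    IsParallelFamilyNear ε m f p := by
  rcases lt_or_gt_of_ne hν with h | h
  · exact isParallelFamilyNear_of_neg hε hf hη h hν1 hην p
  · refine isParallelFamilyNear_of_neg (η := fun p => (-1 : ℝ) • η p) (ν := -ν) hε hf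
      ⟨fun p => ?_, fun p v => ?_, fun p => ?_⟩ (by linarith) (by simpa using hν1)
      (fun p => by simp [hην]) p
    · rw [Prod.smul_fst, flatMetric_smul_left, hη.tangent, mul_zero]
    · exact (prodMetric_smul_left _ _ _).trans (mul_eq_zero_of_right _ (hη.normal p v))
    · rw [prodMetric_smul_left, prodMetric_smul_right, hη.unit]; norm_num

end

/-! ### Horizontal normal: the relation of lying on one vertical line -/

section SameLine

variable {M W : Type*} [TopologicalSpace M]

/-- Two points lie on a common vertical line of `f`: they are joined by a curve that `f` maps
to a vertical line parametrized by its height. -/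
def SameLine (f : M → W × ℝ) (p q : M) : Prop :=
  ∃ (S : Set ℝ) (γ : ℝ → M), IsOpen S ∧ IsPreconnected S ∧ (f p).2 ∈ S ∧ (f q).2 ∈ S ∧
    ContinuousOn γ S ∧ (∀ s ∈ S, f (γ s) = ((f p).1, s)) ∧ γ (f p).2 = p ∧ γ (f q).2 = q

variable {f : M → W × ℝ}

theorem SameLine.fst_eq {p q : M} (h : SameLine f p q) : (f p).1 = (f q).1 := by
  obtain ⟨S, γ, -, -, -, hq, -, hf, -, hγq⟩ := h
  have := hf _ hq
  rw [hγq] at this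
  exact (congrArg Prod.fst this).symm

theorem SameLine.eq_of_snd_eq {p q : M} (h : SameLine f p q) (hpq : (f p).2 = (f q).2) :
    p = q := by
  obtain ⟨S, γ, -, -, -, -, -, -, hγp, hγq⟩ := h
  rw [← hγp, hpq, hγq]

theorem SameLine.symm {p q : M} (h : SameLine f p q) : SameLine f q p := by
  have h1 := h.fst_eq
  obtain ⟨S, γ, hS, hS', hp, hq, hc, hf, hγp, hγq⟩ := h
  exact ⟨S, γ, hS, hS', hq, hp, hc, fun s hs => by rw [hf s hs, h1], hγq, hγp⟩

end SameLine

/-! ### Vertical boxes and the space of vertical lines -/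

section Lines

variable {m : ℕ} {M : Type*} [TopologicalSpace M]
  [ChartedSpace (EuclideanSpace ℝ (Fin (m + 1))) M]
  {W : Type*} [NormedAddCommGroup W] [NormedSpace ℝ W]

/-- A box of `M` in which `f : M → W × ℝ` is the product of a map to `W` and the identity
of `ℝ`. -/
structure VerticalBox (m : ℕ) {M : Type*} [TopologicalSpace M]
    [ChartedSpace (EuclideanSpace ℝ (Fin (m + 1))) M]
    {W : Type*} [NormedAddCommGroup W] [NormedSpace ℝ W] (f : M → W × ℝ) where
  L : W →L[ℝ] EuclideanSpace ℝ (Fin m)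
  e : OpenPartialHomeomorph M (EuclideanSpace ℝ (Fin m) × ℝ)
  base : Set (EuclideanSpace ℝ (Fin m))
  J : Set ℝ
  t : ℝ
  isOpen_base : IsOpen base
  isOpen_J : IsOpen J
  isPreconnected_J : IsPreconnected J
  t_mem : t ∈ J
  target_eq : e.target = base ×ˢ J
  apply_eq : ∀ q ∈ e.source, e q = (L (f q).1, (f q).2)
  vertical : ∀ x ∈ base, ∀ s ∈ J, ∀ s' ∈ J, (f (e.symm (x, s))).1 = (f (e.symm (x, s'))).1
  smooth_symm : ContMDiffOn ((𝓡 m).prod 𝓘(ℝ, ℝ)) (𝓡 (m + 1)) ∞ e.symm e.target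
  smooth_fst : ContDiffOn ℝ ∞ (fun x => (f (e.symm (x, t))).1) base

namespace VerticalBox

variable {f : M → W × ℝ} (b : VerticalBox m f)

theorem mem_target {x : EuclideanSpace ℝ (Fin m)} {s : ℝ} :
    (x, s) ∈ b.e.target ↔ x ∈ b.base ∧ s ∈ b.J := by
  rw [b.target_eq, Set.mem_prod]

theorem proj_mem {q : M} (hq : q ∈ b.e.source) : b.L (f q).1 ∈ b.base ∧ (f q).2 ∈ b.J := by
  have := b.e.map_source hq
  rwa [b.apply_eq q hq, b.mem_target] at this

theorem symm_proj {q : M} (hq : q ∈ b.e.source) : b.e.symm (b.L (f q).1, (f q).2) = q := by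
  rw [← b.apply_eq q hq, b.e.left_inv hq]

theorem apply_symm {x : EuclideanSpace ℝ (Fin m)} {s : ℝ} (hx : x ∈ b.base) (hs : s ∈ b.J) :
    b.L (f (b.e.symm (x, s))).1 = x ∧ (f (b.e.symm (x, s))).2 = s := by
  have h := b.mem_target.2 ⟨hx, hs⟩
  have := b.e.right_inv h
  rw [b.apply_eq _ (b.e.map_target h)] at this
  exact ⟨congrArg Prod.fst this, congrArg Prod.snd this⟩

end VerticalBox

variable {f : M → W × ℝ}

theorem VerticalBox.sameLine (b : VerticalBox m f) {p q : M} (hp : p ∈ b.e.source)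
    (hq : q ∈ b.e.source) (h : b.L (f p).1 = b.L (f q).1) : SameLine f p q := by
  obtain ⟨hpb, hpJ⟩ := b.proj_mem hp
  refine ⟨b.J, fun s => b.e.symm (b.L (f p).1, s), b.isOpen_J, b.isPreconnected_J, hpJ,
    (b.proj_mem hq).2, ?_, fun s hs => ?_, b.symm_proj hp, ?_⟩
  · exact b.e.continuousOn_symm.comp (by fun_prop) fun s hs => b.mem_target.2 ⟨hpb, hs⟩
  · refine Prod.ext ?_ (b.apply_symm hpb hs).2
    change (f (b.e.symm (b.L (f p).1, s))).1 = (f p).1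
    rw [b.vertical _ hpb s hs _ hpJ, b.symm_proj hp]
  · change b.e.symm (b.L (f p).1, (f q).2) = q
    rw [h, b.symm_proj hq]

/-- In a box, `f` determines both coordinates. This gives uniqueness of lifts through `f`, used to
glue curves. -/
theorem isLocallyInjective_of_verticalBox (hb : ∀ p, ∃ b : VerticalBox m f, p ∈ b.e.source) :
    IsLocallyInjective f := by
  intro p
  obtain ⟨b, hp⟩ := hb p
  refine ⟨b.e.source, b.e.open_source, hp, fun x hx y hy hxy => ?_⟩
  rw [← b.symm_proj hx, hxy, b.symm_proj hy]

/-- On the overlap of their parameter intervals both curves lift the same vertical segment through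
the locally injective `f`, and they agree at the height of `q`. As `M` is Hausdorff and the overlap
is connected, they agree on all of it and can be glued. -/
theorem SameLine.trans [T2Space M] (hb : ∀ p, ∃ b : VerticalBox m f, p ∈ b.e.source) {p q r : M}
    (h₁ : SameLine f p q) (h₂ : SameLine f q r) : SameLine f p r := by
  classical
  have hpq := h₁.fst_eq
  obtain ⟨S₁, γ₁, hS₁, hS₁', hp, hq, hc₁, hf₁, hγp, hγq⟩ := h₁
  obtain ⟨S₂, γ₂, hS₂, hS₂', hq', hr, hc₂, hf₂, hγq', hγr⟩ := h₂
  have hinter : Set.EqOn γ₁ γ₂ (S₁ ∩ S₂) :=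
    (T2Space.isSeparatedMap f).eqOn_of_comp_eqOn (isLocallyInjective_of_verticalBox hb)
      (hS₁'.ordConnected.inter hS₂'.ordConnected).isPreconnected
      (hc₁.mono Set.inter_subset_left) (hc₂.mono Set.inter_subset_right)
      (fun s hs => by simp [hf₁ s hs.1, hf₂ s hs.2, hpq]) ⟨hq, hq'⟩ (hγq.trans hγq'.symm)
  have e₁ : Set.EqOn (S₁.piecewise γ₁ γ₂) γ₁ S₁ := Set.piecewise_eqOn _ _ _
  have e₂ : Set.EqOn (S₁.piecewise γ₁ γ₂) γ₂ S₂ := fun s hs => by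
    by_cases h : s ∈ S₁
    · rw [e₁ h, hinter ⟨h, hs⟩]
    · rw [Set.piecewise_eq_of_notMem _ _ _ h]
  refine ⟨S₁ ∪ S₂, S₁.piecewise γ₁ γ₂, hS₁.union hS₂, hS₁'.union _ hq hq' hS₂', Or.inl hp,
    Or.inr hr, ?_, ?_, (e₁ hp).trans hγp, (e₂ hr).trans hγr⟩
  · rintro s (hs | hs)
    · exact (((hc₁.congr e₁).continuousAt (hS₁.mem_nhds hs))).continuousWithinAt
    · exact (((hc₂.congr e₂).continuousAt (hS₂.mem_nhds hs))).continuousWithinAt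
  · rintro s (hs | hs)
    · rw [e₁ hs, hf₁ s hs]
    · rw [e₂ hs, hf₂ s hs, hpq]

/-- A saturated set that is a neighbourhood of a point of a box is a neighbourhood of the other
points of the box on the same vertical line. -/
theorem VerticalBox.mem_nhds_of_saturated (hf : Continuous f) (b : VerticalBox m f) {A : Set M}
    (hA : ∀ p q, SameLine f p q → p ∈ A → q ∈ A) {p q : M} (hp : p ∈ b.e.source)
    (hq : q ∈ b.e.source) (h : b.L (f p).1 = b.L (f q).1) (hpA : A ∈ nhds p) : A ∈ nhds q := by
  have hpJ := (b.proj_mem hp).2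
  have hmem : ∀ y ∈ b.e.source, (b.L (f y).1, (f p).2) ∈ b.e.target := fun y hy =>
    b.mem_target.2 ⟨(b.proj_mem hy).1, hpJ⟩
  have hval : b.e.symm (b.L (f q).1, (f p).2) = p := by rw [← h, b.symm_proj hp]
  have hcont : ContinuousAt (fun y => b.e.symm (b.L (f y).1, (f p).2)) q :=
    ContinuousAt.comp (f := fun y => (b.L (f y).1, (f p).2)) (b.e.continuousAt_symm (hmem q hq))
      (by fun_prop)
  have h1 : ∀ᶠ y in nhds q, b.e.symm (b.L (f y).1, (f p).2) ∈ A :=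
    hcont.eventually_mem (by rwa [hval])
  filter_upwards [h1, b.e.open_source.mem_nhds hq] with y hyA hy
  exact hA _ _ (b.sameLine (b.e.map_target (hmem y hy)) hy
    (b.apply_symm (b.proj_mem hy).1 hpJ).1) hyA

variable [T2Space M]

/-- Lying on a common vertical line is an equivalence relation. -/
def lineSetoid (hb : ∀ p, ∃ b : VerticalBox m f, p ∈ b.e.source) : Setoid M where
  r := SameLine f
  iseqv := ⟨fun p => (hb p).elim fun b hp => b.sameLine hp hp rfl, SameLine.symm,
    SameLine.trans hb⟩

/-- The saturation `A` of an open set must be shown open. Being a neighbourhood of a point passes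
along a line inside each box, hence along the whole line, whose parameter set is connected. -/
theorem isOpenMap_lineSetoid_mk (hf : Continuous f)
    (hb : ∀ p, ∃ b : VerticalBox m f, p ∈ b.e.source) :
    IsOpenMap (Quotient.mk (lineSetoid hb)) := by
  intro U hU
  have hmk : ∀ p q, Quotient.mk (lineSetoid hb) p = Quotient.mk (lineSetoid hb) q ↔
    SameLine f p q := fun p q => Quotient.eq
  rw [← isQuotientMap_quotient_mk'.isOpen_preimage]
  set A := Quotient.mk (lineSetoid hb) ⁻¹' (Quotient.mk (lineSetoid hb) '' U)
  change IsOpen A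
  have hsat : ∀ p q, SameLine f p q → p ∈ A → q ∈ A := by
    rintro p q hpq ⟨w, hw, hwp⟩
    exact ⟨w, hw, hwp.trans ((hmk p q).2 hpq)⟩
  have hUA : U ⊆ A := fun p hp => ⟨p, hp, rfl⟩
  rw [isOpen_iff_mem_nhds]
  rintro q ⟨w, hw, hwq⟩
  obtain ⟨S, γ, hS, hS', hwS, hqS, hc, hfγ, hγw, hγq⟩ := (hmk w q).1 hwq
  have key := hS'.induction₂' (fun s s' => A ∈ nhds (γ s) → A ∈ nhds (γ s')) (fun s hs => by
    obtain ⟨b, hbs⟩ := hb (γ s)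
    have h1 : ∀ᶠ s' in nhdsWithin s S, γ s' ∈ b.e.source :=
      (hc s hs).eventually_mem (b.e.open_source.mem_nhds hbs)
    filter_upwards [h1, self_mem_nhdsWithin] with s' hs' hs'S
    have h2 : b.L (f (γ s)).1 = b.L (f (γ s')).1 := by rw [hfγ s hs, hfγ s' hs'S]
    exact ⟨b.mem_nhds_of_saturated hf hsat hbs hs' h2,
      b.mem_nhds_of_saturated hf hsat hs' hbs h2.symm⟩)
    (fun _ _ _ _ _ _ h1 h2 h => h2 (h1 h)) hwS hqS
  rw [hγw, hγq] at key
  exact key (Filter.mem_of_superset (hU.mem_nhds hw) hUA)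

/-- The map induced by the first component of `f` on the space of vertical lines. -/
def lineFst (hb : ∀ p, ∃ b : VerticalBox m f, p ∈ b.e.source) : Quotient (lineSetoid hb) → W :=
  Quotient.lift (fun p => (f p).1) fun _ _ h => SameLine.fst_eq h

/-- The chart of the space of vertical lines given by a box. -/
noncomputable def lineChart (hf : Continuous f)
    (hb : ∀ p, ∃ b : VerticalBox m f, p ∈ b.e.source) (b : VerticalBox m f) :
    OpenPartialHomeomorph (Quotient (lineSetoid hb)) (EuclideanSpace ℝ (Fin m)) where
  toFun y := b.L (lineFst hb y)
  invFun x := Quotient.mk _ (b.e.symm (x, b.t))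
  source := Quotient.mk _ '' b.e.source
  target := b.base
  map_source' := by
    rintro _ ⟨p, hp, rfl⟩
    exact (b.proj_mem hp).1
  map_target' x hx := ⟨_, b.e.map_target (b.mem_target.2 ⟨hx, b.t_mem⟩), rfl⟩
  left_inv' := by
    rintro _ ⟨p, hp, rfl⟩
    have hx := (b.proj_mem hp).1
    exact Quotient.sound (b.sameLine (b.e.map_target (b.mem_target.2 ⟨hx, b.t_mem⟩)) hp
      (b.apply_symm hx b.t_mem).1)
  right_inv' x hx := (b.apply_symm hx b.t_mem).1
  open_source := isOpenMap_lineSetoid_mk hf hb _ b.e.open_source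
  open_target := b.isOpen_base
  continuousOn_toFun := (b.L.continuous.comp (hf.fst.quotient_lift _)).continuousOn
  continuousOn_invFun := continuous_quotient_mk'.comp_continuousOn
    (b.e.continuousOn_symm.comp (by fun_prop) fun x hx => b.mem_target.2 ⟨hx, b.t_mem⟩)

/-- The charted space structure on the space of vertical lines. -/
noncomputable abbrev lineChartedSpace (hf : Continuous f)
    (hb : ∀ p, ∃ b : VerticalBox m f, p ∈ b.e.source) :
    ChartedSpace (EuclideanSpace ℝ (Fin m)) (Quotient (lineSetoid hb)) where
  atlas := Set.range (lineChart hf hb)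
  chartAt y := lineChart hf hb (hb y.out).choose
  mem_chart_source y := ⟨y.out, (hb y.out).choose_spec, y.out_eq⟩
  chart_mem_atlas _ := ⟨_, rfl⟩

theorem isManifold_lineChartedSpace (hf : Continuous f)
    (hb : ∀ p, ∃ b : VerticalBox m f, p ∈ b.e.source) :
    letI := lineChartedSpace hf hb
    IsManifold (𝓡 m) ∞ (Quotient (lineSetoid hb)) := by
  let := lineChartedSpace hf hb
  refine isManifold_of_contDiffOn _ _ _ ?_
  rintro _ _ ⟨b, rfl⟩ ⟨b', rfl⟩
  -- This is the transition map: lift to the slice at height `b.t`, then project by the other box.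
  have : ContDiffOn ℝ ∞ (fun x => b'.L (f (b.e.symm (x, b.t))).1) b.base :=
    b'.L.contDiff.comp_contDiffOn b.smooth_fst
  refine this.mono fun x hx => ?_
  have := hx.1
  simp only [OpenPartialHomeomorph.trans_source] at this
  exact this.1

end Lines

/-! ### Smoothness of the induced maps on the space of lines -/

section LineSpace

variable {m : ℕ} {M : Type*} [TopologicalSpace M]
  [ChartedSpace (EuclideanSpace ℝ (Fin (m + 1))) M] [T2Space M]
  {W : Type*} [NormedAddCommGroup W] [NormedSpace ℝ W] {f : M → W × ℝ}

theorem contMDiff_lineFst (hf : Continuous f)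
    (hb : ∀ p, ∃ b : VerticalBox m f, p ∈ b.e.source) :
    letI := lineChartedSpace hf hb
    ContMDiff (𝓡 m) 𝓘(ℝ, W) ∞ (lineFst hb) := by
  let := lineChartedSpace hf hb
  have := isManifold_lineChartedSpace hf hb
  intro y
  set b := (hb y.out).choose
  have hy : y ∈ (lineChart hf hb b).source := mem_chart_source (EuclideanSpace ℝ (Fin m)) y
  have hc : ContMDiffOn (𝓡 m) (𝓡 m) ∞ (lineChart hf hb b) (lineChart hf hb b).source :=
    contMDiffOn_chart (x := y)
  have h1 : ContMDiffOn (𝓡 m) 𝓘(ℝ, W) ∞ (lineFst hb) (lineChart hf hb b).source := by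
    refine (b.smooth_fst.contMDiffOn.comp hc (lineChart hf hb b).mapsTo).congr fun z hz => ?_
    exact (congrArg (lineFst hb) ((lineChart hf hb b).left_inv hz)).symm
  exact h1.contMDiffAt ((lineChart hf hb b).open_source.mem_nhds hy)

/-- Every chart of the quotient factors as `b.L ∘ lineFst`, and the differential of a chart is
injective. -/
theorem injective_mfderiv_lineFst (hf : Continuous f)
    (hb : ∀ p, ∃ b : VerticalBox m f, p ∈ b.e.source) (y : Quotient (lineSetoid hb)) :
    letI := lineChartedSpace hf hb
    Function.Injective (mfderiv (𝓡 m) 𝓘(ℝ, W) (lineFst hb) y) := by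
  let := lineChartedSpace hf hb
  have := isManifold_lineChartedSpace hf hb
  set b := (hb y.out).choose
  have hinj : Function.Injective (mfderiv (𝓡 m) (𝓡 m) (b.L ∘ lineFst hb) y) :=
    (mdifferentiable_chart (I := 𝓡 m) y).mfderiv_injective (mem_chart_source _ y)
  rw [mfderiv_comp y b.L.mdifferentiableAt
    ((contMDiff_lineFst hf hb).mdifferentiable (by simp) y)] at hinj
  intro v w hvw
  exact hinj (congrArg (mfderiv 𝓘(ℝ, W) (𝓡 m) b.L (lineFst hb y)) hvw)

/-- In the chart of a box, the map is the box coordinate map `b.e` itself, so its local inverse is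
`b.e.symm` after that chart. -/
theorem isLocalDiffeomorph_lineSpace (hf : ContMDiff (𝓡 (m + 1)) 𝓘(ℝ, W × ℝ) ∞ f)
    (hb : ∀ p, ∃ b : VerticalBox m f, p ∈ b.e.source) :
    letI := lineChartedSpace hf.continuous hb
    IsLocalDiffeomorph (𝓡 (m + 1)) ((𝓡 m).prod 𝓘(ℝ, ℝ)) ∞
      fun p => (Quotient.mk (lineSetoid hb) p, (f p).2) := by
  let := lineChartedSpace hf.continuous hb
  have := isManifold_lineChartedSpace hf.continuous hb
  intro p
  obtain ⟨b, hp⟩ := hb p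
  set κ := lineChart hf.continuous hb b
  have hκm : κ ∈ IsManifold.maximalAtlas (𝓡 m) ∞ (Quotient (lineSetoid hb)) :=
    IsManifold.subset_maximalAtlas ⟨b, rfl⟩
  have hf1 : ContMDiff (𝓡 (m + 1)) (𝓡 m) ∞ fun q => b.L (f q).1 :=
    (b.L.comp (.fst ℝ W ℝ)).contMDiff.comp hf
  have hf2 : ContMDiff (𝓡 (m + 1)) 𝓘(ℝ, ℝ) ∞ fun q => (f q).2 :=
    (ContinuousLinearMap.snd ℝ W ℝ).contMDiff.comp hf
  have hinv : ∀ q ∈ κ.source ×ˢ b.J, (κ q.1, q.2) ∈ b.e.target := fun q hq =>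
    b.mem_target.2 ⟨κ.map_source hq.1, hq.2⟩
  refine ⟨⟨⟨fun q => (Quotient.mk (lineSetoid hb) q, (f q).2), fun q => b.e.symm (κ q.1, q.2),
    b.e.source, κ.source ×ˢ b.J, fun q hq => ⟨⟨q, hq, rfl⟩, (b.proj_mem hq).2⟩,
    fun q hq => b.e.map_target (hinv q hq), fun q hq => b.symm_proj hq, ?_⟩, b.e.open_source,
    κ.open_source.prod b.isOpen_J, ?_, ?_⟩, hp, fun _ _ => rfl⟩
  · rintro ⟨y, s⟩ hq
    have h1 := b.apply_symm (κ.map_source hq.1) hq.2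
    refine Prod.ext (κ.injOn ⟨_, b.e.map_target (hinv _ hq), rfl⟩ hq.1 h1.1) h1.2
  · refine ContMDiffOn.prodMk ?_ hf2.contMDiffOn
    refine ((contMDiffOn_symm_of_mem_maximalAtlas hκm).comp hf1.contMDiffOn
      fun q hq => (b.proj_mem hq).1).congr fun q hq => ?_
    exact (κ.left_inv ⟨q, hq, rfl⟩).symm
  · refine b.smooth_symm.comp (ContMDiffOn.prodMk ?_ contMDiffOn_snd) hinv
    exact (contMDiffOn_of_mem_maximalAtlas hκm).comp contMDiffOn_fst fun q hq => hq.1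

end LineSpace

/-! ### Horizontal normal: open parts of products -/

section Product

variable {ε : ℝ} {m : ℕ} {M : Type u} [TopologicalSpace M]
  [ChartedSpace (EuclideanSpace ℝ (Fin (m + 1))) M] [IsManifold (𝓡 (m + 1)) ∞ M]
  {f η : M → Flat (m + 1) × ℝ}

/-- Since `η` is horizontal, `∂/∂t` is orthogonal to it and hence tangent. The flow box of its
preimage under `dF`, with `F` itself as the straightening map, is the required box. -/
theorem exists_verticalBox (hε : ε = 1 ∨ ε = -1) (hf : IsHypersurface ε m f)
    (hη : IsUnitNormal ε m f η) (hη0 : ∀ p, (η p).2 = 0) (p : M) :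
    ∃ b : VerticalBox m f, p ∈ b.e.source := by
  have h := hf.isLocalHypersurface hη p
  have hps := mem_chart_source (EuclideanSpace ℝ (Fin (m + 1))) p
  set ch := chartAt (EuclideanSpace ℝ (Fin (m + 1))) p
  set F := f ∘ ch.symm
  have hX : ∀ z ∈ ch.target, ∃ X, fderiv ℝ F z X = (0, 1) := fun z hz =>
    h.exists_fderiv_eq hε hz (by simp [flatMetric])
      (by rw [prodMetric_comm]; exact (prodMetric_dt _).trans (hη0 _))
  choose! X hX using hX
  obtain ⟨L, e, r, hr, hze, heO, hee, htarget, hes, hline⟩ :=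
    exists_flow_box h.isOpen h.smooth (ch.map_source hps) (h.injective _ (ch.map_source hps)) hX
  have htgt : (ch.trans e).target = e.target := by
    rw [OpenPartialHomeomorph.trans_target]
    exact Set.inter_eq_left.2 fun q hq => heO (e.map_target hq)
  have hmem : ∀ x ∈ Metric.ball (L (F (ch p)).1) r, ∀ s ∈ Set.Ioo ((F (ch p)).2 - r)
      ((F (ch p)).2 + r), (x, s) ∈ e.target ∧ e.symm (x, s) ∈ ch.target := fun x hx s hs => by
    have h1 : (x, s) ∈ e.target := by rw [htarget]; exact ⟨hx, hs⟩
    exact ⟨h1, heO (e.map_target h1)⟩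
  have htJ : (F (ch p)).2 ∈ Set.Ioo ((F (ch p)).2 - r) ((F (ch p)).2 + r) := by
    constructor <;> linarith
  refine ⟨⟨L, ch.trans e, Metric.ball (L (F (ch p)).1) r,
    Set.Ioo ((F (ch p)).2 - r) ((F (ch p)).2 + r), (F (ch p)).2, Metric.isOpen_ball, isOpen_Ioo,
    isPreconnected_Ioo, htJ, htgt.trans htarget, fun q hq => ?_, fun x hx s hs s' hs' => ?_,
    ?_, ?_⟩, ?_⟩
  · rw [OpenPartialHomeomorph.trans_source] at hq
    rw [OpenPartialHomeomorph.coe_trans, Function.comp_apply, hee]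
    simp only [F, Function.comp_apply, ch.left_inv hq.1]
  · refine eq_of_fderiv_apply_eq_zero (h := e.symm) (u := fun z => (F z).1) (X := X)
      (fun s hs => hline x s (hmem x hx s hs).1) (fun s hs => ?_) hs hs'
    have h1 := (h.hasFDerivAt (hmem x hx s hs).2).fst
    refine ⟨h1.differentiableAt, ?_⟩
    rw [h1.fderiv]
    exact congrArg Prod.fst (hX _ (hmem x hx s hs).2)
  · rw [htgt]
    exact contMDiffOn_chart_symm.comp (contMDiffOn_prod_model_iff'.2 hes)
      fun q hq => heO (e.map_target hq)
  · exact (contDiff_fst.comp_contDiffOn h.smooth).comp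
      (hes.comp (contDiff_id.prodMk contDiff_const).contDiffOn fun x hx => (hmem x hx _ htJ).1)
      fun x hx => (hmem x hx _ htJ).2
  · rw [OpenPartialHomeomorph.trans_source]
    exact ⟨hps, hze⟩

/-- The manifold is the space of vertical lines, second countable because the quotient map is open.
Injectivity of `ψ` holds because the curve joining two points of a line is parametrized by height.
-/
theorem isOpenPartOfProduct_of_normal_horizontal [T2Space M] [SecondCountableTopology M]
    (hε : ε = 1 ∨ ε = -1) (hf : IsHypersurface ε m f)
    (hη : IsUnitNormal ε m f η) (hη0 : ∀ p, (η p).2 = 0) : IsOpenPartOfProduct ε m f := by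
  have hb := exists_verticalBox hε hf hη hη0
  have hc := hf.smooth.continuous
  let := lineChartedSpace hc hb
  refine ⟨Quotient (lineSetoid hb), inferInstance,
    TopologicalSpace.Quotient.secondCountableTopology (isOpenMap_lineSetoid_mk hc hb), lineChartedSpace hc hb,
    isManifold_lineChartedSpace hc hb, lineFst hb, fun p => (Quotient.mk _ p, (f p).2),
    ⟨contMDiff_lineFst hc hb, fun y => ?_, injective_mfderiv_lineFst hc hb⟩, fun p q hpq => ?_,
    isLocalDiffeomorph_lineSpace hf.smooth hb, fun p => rfl⟩
  · induction y using Quotient.inductionOn with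
    | h p => exact hf.mem p
  · exact SameLine.eq_of_snd_eq (Quotient.exact (Prod.ext_iff.1 hpq).1) (Prod.ext_iff.1 hpq).2

end Product

end ConstantAngle

/-! ### The case distinction on `ν` -/

theorem theorem5p1 (ε : ℝ) (hε : ε = 1 ∨ ε = -1) (m : ℕ)
    {M : Type u} [TopologicalSpace M] [T2Space M] [SecondCountableTopology M] [ConnectedSpace M]
    [ChartedSpace (EuclideanSpace ℝ (Fin (m + 1))) M] [IsManifold (𝓡 (m + 1)) ∞ M]
    (f : M → ConstantAngle.Flat (m + 1) × ℝ) (hf : ConstantAngle.IsHypersurface ε m f)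
    (η : M → ConstantAngle.Flat (m + 1) × ℝ) (hη : ConstantAngle.IsUnitNormal ε m f η)
    (ν : ℝ) (hν : ∀ p, ConstantAngle.prodMetric ε (η p) (ConstantAngle.dt (m + 1)) = ν) :
    ConstantAngle.IsOpenPartOfSlice ε f ∨
    ConstantAngle.IsOpenPartOfProduct ε m f ∨
    ∀ p, ConstantAngle.IsParallelFamilyNear ε m f p := by
  have hην : ∀ p, (η p).2 = ν := fun p => (ConstantAngle.prodMetric_dt _).symm.trans (hν p)
  obtain ⟨p₀⟩ : Nonempty M := inferInstance
  have hle : ν ^ 2 ≤ 1 := by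
    have hp := mem_chart_source (EuclideanSpace ℝ (Fin (m + 1))) p₀
    rw [← hην p₀]
    have := (hf.isLocalHypersurface hη p₀).sq_le_one hε
      ((chartAt (EuclideanSpace ℝ (Fin (m + 1))) p₀).map_source hp)
    rwa [Function.comp_apply, (chartAt _ p₀).left_inv hp] at this
  rcases eq_or_lt_of_le hle with h1 | h1
  · exact Or.inl (ConstantAngle.isOpenPartOfSlice_of_normal_vertical hε hf hη
      fun p => by rw [hην, h1])
  · rcases eq_or_ne ν 0 with rfl | h0
    · exact Or.inr (Or.inl
        (ConstantAngle.isOpenPartOfProduct_of_normal_horizontal hε hf hη hην))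
    · exact Or.inr (Or.inr (ConstantAngle.isParallelFamilyNear hε hf hη h0 h1 hην))
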